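/- Let $P$ be a complex polynomial of degree $d\ge 2$, extended to the Riemann sphere $\overline{\mathbb C}=\mathbb C\cup\{\infty\}$ by $P(\infty)=\infty$, and let $P^n$ be its $n$-th iterate. For a Borel measure $\nu$ on $\overline{\mathbb C}$ let $P^*\nu$ be the Borel measure $$(P^*\nu)(B)=\int_{\overline{\mathbb C}}\ \sum_{w\in B,\ P(w)=z} m_P(w)\ d\nu(z),$$ where $m_P(w)$ is the multiplicity of $P$ at $w$: the order of vanishing of $P-P(w)$ at $w$ if $w\in\mathbb C$, and $m_P(\infty)=d$. Define $(P^n)^*\nu$ in the same way with $P^n$ (of degree $d^n$) in place of $P$. Let $E$ be the exceptional set of $P$, that is, the largest finite set $S\subset\overline{\mathbb C}$ with $P(S)=S=P^{-1}(S)$. Then there is a unique Borel probability measure $\mu$ on $\overline{\mathbb C}$ such that $\frac1d P^*\mu=\mu$ and $\mu(E)=0$. Moreover, for every Borel probability measure $\nu$ on $\overline{\mathbb C}$ with $\nu(E)=0$, $$\frac{(P^n)^*\nu}{d^n}\longrightarrow\mu\quad\text{weakly as } n\to\infty.$$ In particular, for $x\in\overline{\mathbb C}$, the measures $\mu_{n,x}=\frac{1}{d^n}(P^n)^*\delta_x=\frac1{d^n}\sum_{P^n(w)=x}\delta_w$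 (preimages counted with multiplicity) converge weakly to $\mu$ if and only if $x\notin E$. -/

import Mathlib

open Polynomial MeasureTheory Filter
open scoped Topology ENNReal

/-- The Riemann sphere, as the one-point compactification of the complex plane. -/
abbrev RiemannSphere : Type := OnePoint ℂ

/-- The Riemann sphere carries its Borel sigma-algebra. -/
noncomputable instance instMeasurableSpaceRiemannSphere : MeasurableSpace (OnePoint ℂ) :=
  borel (OnePoint ℂ)

instance instBorelSpaceRiemannSphere : BorelSpace (OnePoint ℂ) := ⟨rfl⟩

namespace PolyDyn

/-- The extension of a (nonconstant) polynomial to the Riemann sphere, fixing `∞`. -/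
noncomputable def sphereMap (P : ℂ[X]) : RiemannSphere → RiemannSphere :=
  OnePoint.map (fun z => P.eval z)

/-- The multiplicity (local degree) of a nonconstant polynomial at a point `w` of the sphere: the
order of vanishing of `P - P(w)` at a finite point `w`, and the degree of `P` at `∞`. -/
noncomputable def localDegree (P : ℂ[X]) : RiemannSphere → ℕ
  | OnePoint.infty => P.natDegree
  | OnePoint.some w => (P - C (P.eval w)).rootMultiplicity w

/-- The `n`-th iterate `P ∘ ⋯ ∘ P`, as a polynomial. -/
noncomputable def iter (P : ℂ[X]) (n : ℕ) : ℂ[X] := P.comp^[n] X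

/-- A subset of the sphere is completely invariant if it equals its image and its preimage. -/
def IsCompletelyInvariant (P : ℂ[X]) (S : Set RiemannSphere) : Prop :=
  sphereMap P '' S = S ∧ sphereMap P ⁻¹' S = S

/-- The exceptional set: the largest finite completely invariant subset of the sphere, that is,
the union of all of them (`isGreatest_exceptionalSet` below). -/
def exceptionalSet (P : ℂ[X]) : Set RiemannSphere :=
  ⋃₀ {S : Set RiemannSphere | S.Finite ∧ IsCompletelyInvariant P S}

/-- The sum of the point masses at the preimages of `z`, counted with multiplicity. -/
noncomputable def fiberMeasure (P : ℂ[X]) (z : RiemannSphere) : Measure RiemannSphere :=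
  Measure.sum fun w : sphereMap P ⁻¹' {z} =>
    (localDegree P w : ℝ≥0∞) • Measure.dirac (w : RiemannSphere)

/-- The pullback `P^* ν`: its value on a Borel set `B` is the `ν`-integral over `z` of the number
of preimages of `z` in `B`, counted with multiplicity (`pullback_apply` below). -/
noncomputable def pullback (P : ℂ[X]) (ν : Measure RiemannSphere) : Measure RiemannSphere :=
  ν.bind (fiberMeasure P)

/-! ### The pullback is well defined, with mass multiplied by the degree -/

@[simp] theorem sphereMap_infty (P : ℂ[X]) : sphereMap P OnePoint.infty = OnePoint.infty := rfl

@[simp] theorem sphereMap_coe (P : ℂ[X]) (w : ℂ) :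
    sphereMap P (w : RiemannSphere) = ((P.eval w : ℂ) : RiemannSphere) := rfl

theorem sphereMap_eq_infty {P : ℂ[X]} {w : RiemannSphere} :
    sphereMap P w = OnePoint.infty ↔ w = OnePoint.infty := by
  induction w using OnePoint.rec <;> simp

theorem localDegree_infty (P : ℂ[X]) : localDegree P OnePoint.infty = P.natDegree := rfl

theorem localDegree_coe (P : ℂ[X]) (w : ℂ) :
    localDegree P (w : RiemannSphere) = (P - C (P.eval w)).rootMultiplicity w := rfl

theorem natDegree_iter (P : ℂ[X]) (n : ℕ) : (iter P n).natDegree = P.natDegree ^ n := by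
  simp [iter, natDegree_iterate_comp]

theorem sphereMap_iter (P : ℂ[X]) (n : ℕ) : sphereMap (iter P n) = (sphereMap P)^[n] := by
  funext w
  induction w using OnePoint.rec with
  | infty =>
    have : (sphereMap P)^[n] OnePoint.infty = OnePoint.infty := Function.iterate_fixed (sphereMap_infty P) n
    rw [this]; rfl
  | coe w =>
    have h : ∀ n, (sphereMap P)^[n] (w : RiemannSphere) =
        (((fun x => P.eval x)^[n] w : ℂ) : RiemannSphere) := by
      intro n
      induction n with
      | zero => rfl
      | succ n ih => rw [Function.iterate_succ_apply', Function.iterate_succ_apply', ih]; rfl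
    rw [h, sphereMap_coe, iter, iterate_comp_eval, eval_X]

theorem fiberMeasure_apply (P : ℂ[X]) (z : RiemannSphere) {B : Set RiemannSphere}
    (hB : MeasurableSet B) : fiberMeasure P z B =
      ∑' w : sphereMap P ⁻¹' {z}, (localDegree P w : ℝ≥0∞) * B.indicator 1 (w : RiemannSphere) := by
  simp [fiberMeasure, Measure.sum_apply _ hB, Measure.dirac_apply' _ hB]

theorem fiberMeasure_eq_indicator {P : ℂ[X]} {B : Set RiemannSphere} {k : ℕ}
    (hB : MeasurableSet B) (hinj : Set.InjOn (sphereMap P) B)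
    (hk : ∀ w ∈ B, localDegree P w = k) (z : RiemannSphere) :
    fiberMeasure P z B = (sphereMap P '' B).indicator (fun _ => (k : ℝ≥0∞)) z := by
  rw [fiberMeasure_apply P z hB]
  by_cases hz : z ∈ sphereMap P '' B
  · rw [Set.indicator_of_mem hz]
    obtain ⟨w, hw, rfl⟩ := hz
    rw [tsum_eq_single ⟨w, rfl⟩]
    · simp [hw, hk w hw]
    · rintro ⟨v, hv⟩ hne
      have : v ∉ B := fun hvB => hne (Subtype.ext (hinj hvB hw hv))
      simp [this]
  · rw [Set.indicator_of_notMem hz]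
    refine ENNReal.tsum_eq_zero.2 ?_
    rintro ⟨v, hv⟩
    have : v ∉ B := fun hvB => hz ⟨v, hvB, hv⟩
    simp [this]

theorem localDegree_eq_one {P : ℂ[X]} {w : ℂ} (hw : P.derivative.eval w ≠ 0) :
    localDegree P (w : RiemannSphere) = 1 := by
  rw [localDegree_coe]
  have hne : P - C (P.eval w) ≠ 0 := by
    intro h
    rw [sub_eq_zero.1 h] at hw
    simp at hw
  have h1 : 0 < (P - C (P.eval w)).rootMultiplicity w := by
    rw [rootMultiplicity_pos hne]; simp
  have h2 : ¬ 1 < (P - C (P.eval w)).rootMultiplicity w := by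
    rw [one_lt_rootMultiplicity_iff_isRoot hne]
    simp [hw]
  omega

theorem exists_nhds_injOn {P : ℂ[X]} {w : ℂ} (hw : P.derivative.eval w ≠ 0) :
    ∃ U : Set ℂ, IsOpen U ∧ w ∈ U ∧ U.InjOn (fun z => P.eval z) ∧
      ∀ v ∈ U, P.derivative.eval v ≠ 0 := by
  have hs : HasStrictDerivAt (fun z => P.eval z) (P.derivative.eval w) w := P.hasStrictDerivAt w
  let e := (hs.hasStrictFDerivAt_equiv hw).toOpenPartialHomeomorph _
  refine ⟨e.source ∩ {v | P.derivative.eval v ≠ 0}, ?_, ?_, ?_, fun v hv => hv.2⟩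
  · exact e.open_source.inter (isOpen_ne_fun P.derivative.continuous continuous_const)
  · exact ⟨(hs.hasStrictFDerivAt_equiv hw).mem_toOpenPartialHomeomorph_source, hw⟩
  · exact e.injOn.mono Set.inter_subset_left

theorem measurableEmbedding_coe : MeasurableEmbedding ((↑) : ℂ → RiemannSphere) :=
  OnePoint.isOpenEmbedding_coe.measurableEmbedding

/-- The number of preimages in a Borel set is a Borel function of the point. -/
theorem measurable_fiberMeasure {P : ℂ[X]} (hP : 0 < P.natDegree) :
    Measurable (fiberMeasure P) := by
  have hcrit : {w : ℂ | P.derivative.eval w = 0}.Finite := by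
    refine Polynomial.finite_setOfPred_isRoot ?_
    intro h
    have := derivative_eq_zero.1 h
    omega
  -- the Borel sets all of whose Borel subsets have a measurable counting function
  let good : Set RiemannSphere → Prop := fun A => MeasurableSet A ∧
    ∀ B ⊆ A, MeasurableSet B → Measurable fun z => fiberMeasure P z B
  have hpt : ∀ c, good {c} := by
    refine fun c => ⟨measurableSet_singleton c, fun B hB hBm => ?_⟩
    have := fiberMeasure_eq_indicator (P := P) (k := localDegree P c) hBm
      ((Set.subsingleton_singleton.anti hB).injOn _) (fun w hw => by rw [hB hw])
    simp only [funext this]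
    exact measurable_const.indicator
      ((Set.subsingleton_singleton.anti hB).image _).measurableSet
  have hloc : ∀ U : Set ℂ, IsOpen U → U.InjOn (fun z => P.eval z) →
      (∀ v ∈ U, P.derivative.eval v ≠ 0) → good ((↑) '' U) := by
    intro U hU hinj hd
    refine ⟨measurableEmbedding_coe.measurableSet_image' hU.measurableSet, fun B hB hBm => ?_⟩
    obtain ⟨V, hVU, rfl⟩ := Set.subset_image_iff.1 hB
    have hV : MeasurableSet V := measurableEmbedding_coe.measurableSet_image.1 hBm
    have := fiberMeasure_eq_indicator (P := P) (k := 1) hBm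
      (by
        rintro _ ⟨a, ha, rfl⟩ _ ⟨b, hb, rfl⟩ hab
        rw [sphereMap_coe, sphereMap_coe, OnePoint.coe_eq_coe] at hab
        rw [hinj (hVU ha) (hVU hb) hab])
      (by
        rintro _ ⟨a, ha, rfl⟩
        exact localDegree_eq_one (hd a (hVU ha)))
    simp only [funext this]
    refine measurable_const.indicator ?_
    have himg : sphereMap P '' ((↑) '' V) = (↑) '' ((fun z => P.eval z) '' V) := by
      simp only [Set.image_image, sphereMap_coe]
    rw [himg]
    exact measurableEmbedding_coe.measurableSet_image' (hV.image_of_continuousOn_injOn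
      P.continuous.continuousOn (hinj.mono hVU))
  obtain ⟨T, hTc, hTg, hTu⟩ : ∃ T : Set (Set RiemannSphere), T.Countable ∧
      (∀ A ∈ T, good A) ∧ ⋃₀ T = Set.univ := by
    choose! U hUo hUm hUi hUd using fun w (hw : w ∈ {w : ℂ | P.derivative.eval w ≠ 0}) =>
      exists_nhds_injOn hw
    obtain ⟨t, hts, htc, htu⟩ := TopologicalSpace.countable_cover_nhdsWithin
      (fun w hw => mem_nhdsWithin_of_mem_nhds ((hUo w hw).mem_nhds (hUm w hw)))
    refine ⟨(fun w => (↑) '' U w) '' t ∪ ((fun c : ℂ => {(c : RiemannSphere)}) ''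
      {w : ℂ | P.derivative.eval w = 0} ∪ {{OnePoint.infty}}), ?_, ?_, ?_⟩
    · exact (htc.image _).union ((hcrit.countable.image _).union (Set.countable_singleton _))
    · rintro A (⟨w, hw, rfl⟩ | ⟨c, -, rfl⟩ | rfl)
      · exact hloc _ (hUo w (hts hw)) (hUi w (hts hw)) (hUd w (hts hw))
      · exact hpt _
      · exact hpt _
    · refine Set.eq_univ_of_forall fun z => ?_
      induction z using OnePoint.rec with
      | infty => exact ⟨{OnePoint.infty}, Or.inr (Or.inr rfl), rfl⟩
      | coe z =>
        by_cases hz : P.derivative.eval z = 0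
        · exact ⟨{(z : RiemannSphere)}, Or.inr (Or.inl ⟨z, hz, rfl⟩), rfl⟩
        · obtain ⟨w, hw, hzw⟩ := Set.mem_iUnion₂.1 (htu hz)
          exact ⟨(↑) '' U w, Or.inl ⟨w, hw, rfl⟩, ⟨z, hzw, rfl⟩⟩
  have hTne : T.Nonempty := by
    by_contra h
    rw [Set.not_nonempty_iff_eq_empty.1 h, Set.sUnion_empty] at hTu
    exact Set.empty_ne_univ hTu
  obtain ⟨A, rfl⟩ := hTc.exists_eq_range hTne
  rw [Set.sUnion_range] at hTu
  have hA : ∀ n, good (A n) := fun n => hTg _ ⟨n, rfl⟩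
  refine Measure.measurable_of_measurable_coe _ fun B hB => ?_
  have hDm : ∀ n, MeasurableSet (disjointed A n) := fun n =>
    MeasurableSet.disjointed (fun n => (hA n).1) n
  have hsum : ∀ z, fiberMeasure P z B = ∑' n, fiberMeasure P z (B ∩ disjointed A n) := by
    intro z
    rw [← measure_iUnion ?_ fun n => hB.inter (hDm n), ← Set.inter_iUnion, iUnion_disjointed,
      hTu, Set.inter_univ]
    exact fun i j hij => (disjoint_disjointed A hij).mono Set.inter_subset_right
      Set.inter_subset_right
  simp only [hsum]
  exact Measurable.tsum fun n => (hA n).2 _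
    (Set.inter_subset_right.trans (disjointed_subset A n)) (hB.inter (hDm n))

/-- Every point of the sphere has `deg P` preimages, counted with multiplicity. -/
theorem fiberMeasure_univ {P : ℂ[X]} (hP : 0 < P.natDegree) (z : RiemannSphere) :
    fiberMeasure P z Set.univ = P.natDegree := by
  rw [fiberMeasure_apply P z MeasurableSet.univ]
  induction z using OnePoint.rec with
  | infty =>
    rw [tsum_eq_single ⟨OnePoint.infty, rfl⟩]
    · simp [localDegree_infty]
    · rintro ⟨v, hv⟩ hne
      exact absurd (Subtype.ext (sphereMap_eq_infty.1 hv)) hne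
  | coe z =>
    have hne : P - C z ≠ 0 := by
      intro h
      rw [sub_eq_zero.1 h] at hP
      simp at hP
    have hcard : ∑ w ∈ (P - C z).roots.toFinset, (P - C z).roots.count w = P.natDegree := by
      rw [Multiset.toFinset_sum_count_eq, IsAlgClosed.card_roots_eq_natDegree, natDegree_sub_C]
    have hfib : sphereMap P ⁻¹' {(z : RiemannSphere)} =
        ((P - C z).roots.toFinset.map ⟨((↑) : ℂ → RiemannSphere), OnePoint.coe_injective⟩ :
          Finset RiemannSphere) := by
      ext w
      induction w using OnePoint.rec with
      | infty => simp
      | coe w => simp [hne, sub_eq_zero]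
    rw [hfib, Finset.tsum_subtype' _ (fun w : RiemannSphere =>
      (localDegree P w : ℝ≥0∞) * Set.univ.indicator 1 w), Finset.sum_map, ← hcard, Nat.cast_sum]
    refine Finset.sum_congr rfl fun w hw => ?_
    have hw' : P.eval w = z := by simpa [hne, sub_eq_zero] using hw
    simp [localDegree_coe, hw']

theorem pullback_apply {P : ℂ[X]} (hP : 0 < P.natDegree) (ν : Measure RiemannSphere)
    {B : Set RiemannSphere} (hB : MeasurableSet B) :
    pullback P ν B = ∫⁻ z, fiberMeasure P z B ∂ν :=
  Measure.bind_apply hB (measurable_fiberMeasure hP).aemeasurable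

/-- The normalized pullback `(P^n)^* ν / d^n` of a probability measure by the `n`-th iterate of a
polynomial of degree `d ≥ 1`, which is again a probability measure. -/
noncomputable def normalizedPullback (P : ℂ[X]) (hP : 0 < P.natDegree) (n : ℕ)
    (ν : ProbabilityMeasure RiemannSphere) : ProbabilityMeasure RiemannSphere :=
  ⟨((P.natDegree : ℝ≥0∞) ^ n)⁻¹ • pullback (iter P n) ν, ⟨by
    have h : 0 < (iter P n).natDegree := by rw [natDegree_iter]; positivity
    have h0 : (P.natDegree : ℝ≥0∞) ^ n ≠ 0 := pow_ne_zero _ (by exact_mod_cast hP.ne')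
    have h1 : (P.natDegree : ℝ≥0∞) ^ n ≠ ⊤ := ENNReal.pow_ne_top (ENNReal.natCast_ne_top _)
    simp [pullback_apply h, fiberMeasure_univ h, natDegree_iter, ENNReal.inv_mul_cancel h0 h1]⟩⟩

/-- A finite completely invariant set has at most one finite point, namely the only critical
point; hence the union of all of them is finite, and is the largest one. -/
theorem isGreatest_exceptionalSet {P : ℂ[X]} (hP : 2 ≤ P.natDegree) :
    IsGreatest {S : Set RiemannSphere | S.Finite ∧ IsCompletelyInvariant P S} (exceptionalSet P) := by
  have hder : P.derivative ≠ 0 := by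
    intro h
    have := derivative_eq_zero.1 h
    omega
  have hsub : ∀ S : Set RiemannSphere, S.Finite → IsCompletelyInvariant P S →
      ∀ z : ℂ, (z : RiemannSphere) ∈ S → P.derivative.eval z = 0 := by
    intro S hS ⟨himg, hpre⟩ z hz
    by_contra hd
    have hmaps : Set.MapsTo (sphereMap P) S S := fun w hw => himg ▸ Set.mem_image_of_mem _ hw
    have hinj : Set.InjOn (sphereMap P) S :=
      ((hS.surjOn_iff_bijOn_of_mapsTo hmaps).1 himg.ge).injOn
    have hmem := hmaps hz
    have hu := fiberMeasure_univ (P := P) (by omega) (sphereMap P z)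
    rw [fiberMeasure_apply P _ MeasurableSet.univ, tsum_eq_single ⟨(z : RiemannSphere), rfl⟩] at hu
    · simp only [localDegree_eq_one hd, Set.indicator_univ, Pi.one_apply, mul_one] at hu
      have : 1 = P.natDegree := by exact_mod_cast hu
      omega
    · rintro ⟨v, hv⟩ hne
      have hvS : v ∈ S := by
        rw [← hpre, Set.mem_preimage, show sphereMap P v = _ from hv]
        exact hmem
      exact absurd (Subtype.ext (hinj hvS hz hv)) hne
  refine ⟨⟨?_, ?_, ?_⟩, fun S hS => Set.subset_sUnion_of_mem hS⟩
  · refine (((finite_setOfPred_isRoot hder).image ((↑) : ℂ → RiemannSphere)).insert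
      OnePoint.infty).subset ?_
    rintro w ⟨S, ⟨hS, hinv⟩, hw⟩
    induction w using OnePoint.rec with
    | infty => exact Or.inl rfl
    | coe z => exact Or.inr ⟨z, hsub S hS hinv z hw, rfl⟩
  · rw [exceptionalSet, Set.sUnion_eq_biUnion, Set.image_iUnion₂]
    exact Set.iUnion₂_congr fun S hS => hS.2.1
  · rw [exceptionalSet, Set.sUnion_eq_biUnion, Set.preimage_iUnion₂]
    exact Set.iUnion₂_congr fun S hS => hS.2.2

end PolyDyn

namespace PolyDyn

/-! ### Fibres of polynomials -/

/-! The proof is potential-theoretic. Write `d` for the degree of `Q`. Up to an additive constant,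
`d⁻ⁿ log ‖Qⁿ(w) - y‖` is the logarithmic potential of the normalized fibre of `Qⁿ` over `y`. It is
compared with `d⁻ⁿ log⁺ ‖Qⁿ(w)‖`, which does not involve `y` and is uniformly Cauchy in `n`
(`exists_abs_greenApprox_succ_sub_le`). The two can differ much only where `Qⁿ(w)` is very close to
`y`. If no disc of a fixed radius contains a fibre, a Łojasiewicz inequality with exponent `q = d -
1` holds (`exists_root_pow_le`). Its iteration costs `qⁿ` against `dⁿ` (`exists_iter_root_pow_le`),
so the difference tends to zero in `L¹` on discs (`tendsto_lintegral_log_sub_greenApprox`).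

Fibres are spread out by Gauss–Lucas: a disc containing a fibre contains every critical point
(`norm_sub_lt_of_forall_root`). If `P ∘ P` has two critical points, this applies to `Q = P ∘ P` over
the whole plane. Otherwise `P = a (X - c)^d + c`, the finite exceptional point is `c`, and the
argument runs for `Q = P` away from `c`.

To return from potentials to measures without a Laplacian, test functions are smoothed by a bump
that is a difference of circle averages of `log` (`sum_bump_eq_circleAverage`). Sums of bumps over a
fibre are then circle averages of its potential.

On the sphere, the pullback of measures is dual to averaging over fibres. Compactness of the space
of probability measures supplies `μ`, continuity of fibre averages its invariance, and small forward
invariant neighbourhoods of exceptional points give `μ(E) = 0`. Dominated convergence passes from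
point masses to general `ν`. An invariant measure with no mass on `E` is the limit of its own
constant sequence of pullbacks, which is uniqueness. -/

theorem sub_C_ne_zero {Q : ℂ[X]} (hQ : 0 < Q.natDegree) (y : ℂ) : Q - C y ≠ 0 := by
  intro h
  rw [sub_eq_zero.1 h] at hQ
  simp at hQ

theorem mem_roots_sub_C_iff {Q : ℂ[X]} (hQ : 0 < Q.natDegree) {y v : ℂ} :
    v ∈ (Q - C y).roots ↔ Q.eval v = y := by
  rw [mem_roots (sub_C_ne_zero hQ y), IsRoot.def, eval_sub, eval_C, sub_eq_zero]

theorem card_roots_sub_C (Q : ℂ[X]) (y : ℂ) : (Q - C y).roots.card = Q.natDegree := by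
  rw [IsAlgClosed.card_roots_eq_natDegree, natDegree_sub_C]

theorem leadingCoeff_sub_C {Q : ℂ[X]} (hQ : 0 < Q.natDegree) (y : ℂ) :
    (Q - C y).leadingCoeff = Q.leadingCoeff :=
  leadingCoeff_sub_of_degree_lt (degree_C_le.trans_lt (natDegree_pos_iff_degree_pos.1 hQ))

theorem sub_C_eq_prod {Q : ℂ[X]} (hQ : 0 < Q.natDegree) (y : ℂ) :
    Q - C y = C Q.leadingCoeff * ((Q - C y).roots.map fun v => X - C v).prod := by
  rw [← leadingCoeff_sub_C hQ y]
  exact (IsAlgClosed.splits (Q - C y)).eq_prod_roots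

theorem eval_sub_eq_prod {Q : ℂ[X]} (hQ : 0 < Q.natDegree) (y w : ℂ) :
    Q.eval w - y = Q.leadingCoeff * ((Q - C y).roots.map fun v => w - v).prod := by
  have h := congrArg (eval w) (sub_C_eq_prod hQ y)
  rw [eval_sub, eval_C] at h
  rw [h, eval_mul, eval_C, eval_multiset_prod, Multiset.map_map]
  simp

theorem norm_eval_sub_eq_prod {Q : ℂ[X]} (hQ : 0 < Q.natDegree) (y w : ℂ) :
    ‖Q.eval w - y‖ = ‖Q.leadingCoeff‖ * ((Q - C y).roots.map fun v => ‖w - v‖).prod := by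
  rw [eval_sub_eq_prod hQ, norm_mul]
  congr 1
  have := map_multiset_prod (normHom : ℂ →*₀ ℝ) ((Q - C y).roots.map fun v => w - v)
  rw [Multiset.map_map] at this
  exact this

/-- Identifies `log ‖Q - y‖` with the potential of the fibre. The fibre itself is excluded because
`Real.log 0 = 0`. -/
theorem log_norm_eval_sub {Q : ℂ[X]} (hQ : 0 < Q.natDegree) {y w : ℂ} (hw : Q.eval w ≠ y) :
    Real.log ‖Q.eval w - y‖ =
      Real.log ‖Q.leadingCoeff‖ + ((Q - C y).roots.map fun v => Real.log ‖w - v‖).sum := by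
  have hne : ∀ v ∈ (Q - C y).roots, ‖w - v‖ ≠ 0 := by
    intro v hv h
    rw [norm_eq_zero, sub_eq_zero] at h
    exact hw (h ▸ (mem_roots_sub_C_iff hQ).1 hv)
  have hlog : ∀ s : Multiset ℝ, (∀ x ∈ s, x ≠ 0) →
      Real.log s.prod = (s.map Real.log).sum := by
    intro s
    induction s using Multiset.induction with
    | empty => simp
    | cons a s ih =>
      intro h
      rw [Multiset.prod_cons, Multiset.map_cons, Multiset.sum_cons,
        Real.log_mul (h a (Multiset.mem_cons_self a s))
          (Multiset.prod_ne_zero fun h0 => h 0 (Multiset.mem_cons_of_mem h0) rfl),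
        ih fun x hx => h x (Multiset.mem_cons_of_mem hx)]
  have hQ0 : Q ≠ 0 := by rintro rfl; simp at hQ
  rw [norm_eval_sub_eq_prod hQ, Real.log_mul (by simpa using hQ0), hlog, Multiset.map_map]
  · rfl
  · intro x hx
    obtain ⟨v, hv, rfl⟩ := Multiset.mem_map.1 hx
    exact hne v hv
  · refine Multiset.prod_ne_zero fun h => ?_
    obtain ⟨v, hv, h0⟩ := Multiset.mem_map.1 h
    exact hne v hv h0

/-- Substitute `B` into the factorization of `A - y`; each factor becomes `B - v`. -/
theorem roots_comp_sub_C {A B : ℂ[X]} (hA : 0 < A.natDegree) (hB : 0 < B.natDegree) (y : ℂ) :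
    (A.comp B - C y).roots = (A - C y).roots.bind fun v => (B - C v).roots := by
  have h : A.comp B - C y =
      C A.leadingCoeff * ((A - C y).roots.map fun v => B - C v).prod := by
    have := congrArg (fun R : ℂ[X] => R.comp B) (sub_C_eq_prod hA y)
    simpa [multiset_prod_comp, Multiset.map_map, Function.comp_def] using this
  have hA0 : A.leadingCoeff ≠ 0 := by
    rw [Ne, leadingCoeff_eq_zero]; rintro rfl; simp at hA
  rw [h, roots_C_mul _ hA0, roots_multiset_prod, Multiset.bind_map]
  intro h0
  obtain ⟨v, -, hv⟩ := Multiset.mem_map.1 h0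
  exact sub_C_ne_zero hB v hv

/-! ### Iterates as polynomials -/

theorem iter_succ (P : ℂ[X]) (n : ℕ) : iter P (n + 1) = P.comp (iter P n) := by
  rw [iter, Function.iterate_succ_apply', iter]

theorem iter_add (P : ℂ[X]) (m n : ℕ) : iter P (m + n) = (iter P m).comp (iter P n) := by
  induction m with
  | zero => simp [iter]
  | succ m ih => rw [Nat.succ_add, iter_succ, iter_succ, ih, comp_assoc]

theorem iter_one (P : ℂ[X]) : iter P 1 = P := by simp [iter]

theorem iter_two_mul (P : ℂ[X]) (n : ℕ) : iter (P.comp P) n = iter P (2 * n) := by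
  induction n with
  | zero => rfl
  | succ n ih =>
    rw [iter_succ, ih, Nat.mul_succ, Nat.add_comm, iter_add]
    simp [iter, comp_assoc]

theorem natDegree_iter_pos {P : ℂ[X]} (hP : 0 < P.natDegree) (n : ℕ) :
    0 < (iter P n).natDegree := by
  rw [natDegree_iter]; positivity

theorem eval_iter_succ (P : ℂ[X]) (n : ℕ) (w : ℂ) :
    (iter P (n + 1)).eval w = P.eval ((iter P n).eval w) := by
  rw [iter_succ, eval_comp]

theorem eval_iter_zero (P : ℂ[X]) (w : ℂ) : (iter P 0).eval w = w := by simp [iter]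

/-! ### A Łojasiewicz inequality along backward orbits -/

/-- If the fibre over `y` is not contained in any disc of radius `δ`, then `Q w` can be close
to `y` only if `w` is close to the fibre, with an exponent less than the degree. -/
theorem exists_root_pow_le {Q : ℂ[X]} (hQ : 0 < Q.natDegree) {y : ℂ} {δ : ℝ} (w : ℂ)
    (hδ : ∃ v, Q.eval v = y ∧ δ ≤ ‖w - v‖) :
    ∃ v, Q.eval v = y ∧
      ‖Q.leadingCoeff‖ * δ * ‖w - v‖ ^ (Q.natDegree - 1) ≤ ‖Q.eval w - y‖ := by
  obtain ⟨u, hu, hδu⟩ := hδ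
  have hu' := (mem_roots_sub_C_iff hQ).2 hu
  obtain ⟨v, hv, hmin⟩ := (Q - C y).roots.toFinset.exists_min_image (fun v => ‖w - v‖)
    ⟨u, Multiset.mem_toFinset.2 hu'⟩
  refine ⟨v, (mem_roots_sub_C_iff hQ).1 (Multiset.mem_toFinset.1 hv), ?_⟩
  -- The factor of the distant root `u` is at least `δ`; each of the other `d - 1` factors is at
  -- least `‖w - v‖`, since `v` is a nearest root.
  rw [norm_eval_sub_eq_prod hQ, ← Multiset.cons_erase hu', Multiset.map_cons, Multiset.prod_cons,
    mul_assoc]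
  refine mul_le_mul_of_nonneg_left ?_ (norm_nonneg _)
  refine mul_le_mul hδu ?_ (by positivity) (norm_nonneg _)
  rw [← card_roots_sub_C Q y, ← Nat.pred_eq_sub_one, ← Multiset.card_erase_of_mem hu',
    ← Multiset.prod_replicate, ← Multiset.map_const']
  exact Multiset.prod_map_le_prod_map₀ _ _ (fun _ _ => norm_nonneg _) fun t ht =>
    hmin t (Multiset.mem_toFinset.2 (Multiset.mem_of_mem_erase ht))

/-- A backward orbit is followed from `y` one root at a time; backward invariance of `Y` keeps it
where the one-step inequality is available. -/
theorem exists_iter_root_pow_le {Q : ℂ[X]} {Y : Set ℂ} {q : ℕ} {K : ℝ} (hq : 0 < q)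
    (hK : 1 ≤ K) (hY : ∀ v, Q.eval v ∈ Y → v ∈ Y)
    (h : ∀ y ∈ Y, ∀ w, ∃ v, Q.eval v = y ∧ ‖w - v‖ ^ q ≤ K * ‖Q.eval w - y‖) (n : ℕ) :
    ∀ y ∈ Y, ∀ w, ∃ v, (iter Q n).eval v = y ∧
      ‖w - v‖ ^ (q ^ n) ≤ K ^ (n * q ^ n) * ‖(iter Q n).eval w - y‖ := by
  induction n with
  | zero => exact fun y _ w => ⟨y, by simp [eval_iter_zero]⟩
  | succ n ih =>
    intro y hy w
    obtain ⟨u, hu, hu'⟩ := h y hy ((iter Q n).eval w)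
    obtain ⟨v, hv, hv'⟩ := ih u (hY u (hu ▸ hy)) w
    refine ⟨v, by rw [eval_iter_succ, hv, hu], ?_⟩
    calc ‖w - v‖ ^ (q ^ (n + 1)) = (‖w - v‖ ^ (q ^ n)) ^ q := by rw [← pow_mul, pow_succ]
      _ ≤ (K ^ (n * q ^ n) * ‖(iter Q n).eval w - u‖) ^ q := by gcongr
      _ = K ^ (n * q ^ (n + 1)) * ‖(iter Q n).eval w - u‖ ^ q := by
        rw [mul_pow, ← pow_mul, pow_succ]; ring_nf
      _ ≤ K ^ (n * q ^ (n + 1)) * (K * ‖(iter Q (n + 1)).eval w - y‖) := by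
        rw [eval_iter_succ]; gcongr
      _ = K ^ (n * q ^ (n + 1) + 1) * ‖(iter Q (n + 1)).eval w - y‖ := by
        rw [pow_succ]; ring
      _ ≤ K ^ ((n + 1) * q ^ (n + 1)) * ‖(iter Q (n + 1)).eval w - y‖ := by
        -- The exponents compare because `1 ≤ q ^ (n + 1)`.
        refine mul_le_mul_of_nonneg_right (pow_le_pow_right₀ hK ?_) (norm_nonneg _)
        · have : 0 < q ^ (n + 1) := by positivity
          rw [Nat.succ_mul]; omega

/-- The root close to `w` depends on `w`. Bounding its term by a normalized sum over all roots gives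
a function of `w` whose integral over a disc is bounded independently of `n`; the price is the term
`n log d`. -/
theorem neg_log_norm_iter_sub_le {Q : ℂ[X]} (hQ : 0 < Q.natDegree) {Y : Set ℂ} {q : ℕ} {K : ℝ}
    (hq : 0 < q) (hK : 1 ≤ K) (hY : ∀ v, Q.eval v ∈ Y → v ∈ Y)
    (h : ∀ y ∈ Y, ∀ w, ∃ v, Q.eval v = y ∧ ‖w - v‖ ^ q ≤ K * ‖Q.eval w - y‖) (n : ℕ)
    {y : ℂ} (hy : y ∈ Y) {w : ℂ} (hw : (iter Q n).eval w ≠ y) :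
    -Real.log ‖(iter Q n).eval w - y‖ ≤ (q : ℝ) ^ n * (n * (Real.log K + Real.log Q.natDegree) +
      ((Q.natDegree : ℝ) ^ n)⁻¹ * ((iter Q n - C y).roots.map fun v => ‖w - v‖⁻¹).sum) := by
  obtain ⟨v, hv, hle⟩ := exists_iter_root_pow_le hq hK hY h n y hy w
  have hwv : 0 < ‖w - v‖ := norm_pos_iff.2 (sub_ne_zero.2 fun h => hw (h ▸ hv))
  have hpos : 0 < ‖(iter Q n).eval w - y‖ := norm_pos_iff.2 (sub_ne_zero.2 hw)
  have h1 := Real.log_le_log (by positivity) hle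
  rw [Real.log_pow, Real.log_mul (by positivity) hpos.ne', Real.log_pow] at h1
  have hD : (0 : ℝ) < (Q.natDegree : ℝ) ^ n := by positivity
  -- This is `log x ≤ x` for `x = d⁻ⁿ ‖w - v‖⁻¹`.
  have h2 : Real.log (((Q.natDegree : ℝ) ^ n)⁻¹ * ‖w - v‖⁻¹) ≤
      ((Q.natDegree : ℝ) ^ n)⁻¹ * ‖w - v‖⁻¹ :=
    (Real.log_le_sub_one_of_pos (by positivity)).trans (by linarith)
  rw [Real.log_mul (by positivity) (by positivity), Real.log_inv, Real.log_inv, Real.log_pow] at h2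
  have h3 : ‖w - v‖⁻¹ ≤ ((iter Q n - C y).roots.map fun v => ‖w - v‖⁻¹).sum := by
    refine Multiset.single_le_sum (fun x hx => ?_) _ (Multiset.mem_map_of_mem _
      ((mem_roots_sub_C_iff (natDegree_iter_pos hQ n)).2 hv))
    obtain ⟨t, -, rfl⟩ := Multiset.mem_map.1 hx
    positivity
  push_cast at h1
  calc -Real.log ‖(iter Q n).eval w - y‖
      ≤ (q : ℝ) ^ n * (n * Real.log K - Real.log ‖w - v‖) := by linarith
    _ ≤ _ := by
      refine mul_le_mul_of_nonneg_left ?_ (by positivity)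
      have := mul_le_mul_of_nonneg_left h3 (inv_nonneg.2 hD.le)
      linarith

/-! ### The approximations of the Green function -/

theorem posLog_multiset_prod_le (s : Multiset ℝ) :
    Real.posLog s.prod ≤ (s.map Real.posLog).sum := by
  induction s using Multiset.induction with
  | empty => simp
  | cons a s ih =>
    rw [Multiset.prod_cons, Multiset.map_cons, Multiset.sum_cons]
    exact Real.posLog_mul.trans (by linarith)

theorem posLog_norm_sub_le (a b : ℂ) :
    Real.posLog ‖a - b‖ ≤ Real.log 2 + Real.posLog ‖a‖ + Real.posLog ‖b‖ := by
  have := Real.posLog_norm_add_le a (-b)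
  rw [← sub_eq_add_neg, norm_neg] at this
  linarith

/-- The upper bound is subadditivity of `log⁺` over the linear factors. For the lower bound, outside
a large disc every factor `‖z - v‖` is at least one, so `log⁺` is `log` and the factorization is
additive; inside the disc `log⁺ ‖z‖` is bounded. -/
theorem exists_abs_posLog_eval_sub_le {P : ℂ[X]} (hP : 0 < P.natDegree) :
    ∃ K, ∀ z, |Real.posLog ‖P.eval z‖ - P.natDegree * Real.posLog ‖z‖| ≤ K := by
  set s := (P - C 0).roots with hs
  have hcard : s.card = P.natDegree := card_roots_sub_C P 0
  set A := (s.map fun v => Real.log 2 + Real.posLog ‖v‖).sum with hA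
  -- The sum of the moduli serves as a bound for each root.
  set M := (s.map fun v => ‖v‖).sum with hM
  have hsum : ∀ z : ℂ, (s.map fun v => Real.log 2 + Real.posLog ‖z‖ + Real.posLog ‖v‖).sum =
      P.natDegree * Real.posLog ‖z‖ + A := by
    intro z
    rw [hA, ← hcard, ← nsmul_eq_mul, ← Multiset.card_map (fun _ => Real.posLog ‖z‖) s,
      ← Multiset.sum_replicate, ← Multiset.map_const', Multiset.map_map, ← Multiset.sum_map_add]
    refine congrArg _ (Multiset.map_congr rfl fun v _ => ?_)
    simp only [Function.comp_apply]
    ring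
  have hA0 : 0 ≤ A := Multiset.sum_nonneg fun x hx => by
    obtain ⟨v, -, rfl⟩ := Multiset.mem_map.1 hx
    have := Real.log_nonneg one_le_two
    have := Real.posLog_nonneg (x := ‖v‖)
    positivity
  have hle : ∀ v ∈ s, ‖v‖ ≤ M := fun v hv =>
    Multiset.single_le_sum (fun x hx => by
      obtain ⟨t, -, rfl⟩ := Multiset.mem_map.1 hx
      positivity) _ (Multiset.mem_map_of_mem _ hv)
  refine ⟨A + |Real.log ‖P.leadingCoeff‖| + Real.posLog ‖P.leadingCoeff‖ +
    P.natDegree * Real.posLog (M + 1), fun z => ?_⟩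
  have n1 := Real.posLog_nonneg (x := ‖P.leadingCoeff‖)
  have n2 : 0 ≤ P.natDegree * Real.posLog (M + 1) := mul_nonneg (by positivity) Real.posLog_nonneg
  have n3 := abs_nonneg (Real.log ‖P.leadingCoeff‖)
  rw [abs_le]
  constructor
  · by_cases hz : ‖z‖ ≤ M + 1
    · have := mul_le_mul_of_nonneg_left (Real.posLog_le_posLog (norm_nonneg z) hz)
        (Nat.cast_nonneg (α := ℝ) P.natDegree)
      have := Real.posLog_nonneg (x := ‖P.eval z‖)
      linarith
    · push Not at hz
      have hone : ∀ v ∈ s, 1 ≤ ‖z - v‖ := fun v hv => by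
        have := norm_sub_norm_le z v
        linarith [hle v hv]
      have hz0 : P.eval z ≠ 0 := fun h0 => by
        have := hone z ((mem_roots_sub_C_iff hP).2 h0)
        rw [sub_self, norm_zero] at this
        linarith
      have hlog := log_norm_eval_sub hP hz0
      rw [sub_zero] at hlog
      have h1 : P.natDegree * Real.posLog ‖z‖ ≤
          A + (s.map fun v => Real.log ‖z - v‖).sum := by
        have : (s.map fun _ => Real.posLog ‖z‖).sum ≤
            (s.map fun v => (Real.log 2 + Real.posLog ‖v‖) + Real.log ‖z - v‖).sum := by
          refine Multiset.sum_map_le_sum_map _ _ fun v hv => ?_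
          have := posLog_norm_sub_le (z - v) (-v)
          rw [sub_neg_eq_add, sub_add_cancel, norm_neg,
            Real.posLog_eq_log (x := ‖z - v‖) (by rw [abs_norm]; exact hone v hv)] at this
          linarith
        rw [Multiset.sum_map_add] at this
        rwa [Multiset.map_const', Multiset.sum_replicate, hcard, nsmul_eq_mul, ← hA] at this
      have h2 : Real.log ‖P.eval z‖ ≤ Real.posLog ‖P.eval z‖ := le_max_right _ _
      have h3 := neg_abs_le (Real.log ‖P.leadingCoeff‖)
      linarith
  · have h := norm_eval_sub_eq_prod hP 0 z
    rw [sub_zero] at h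
    have h1 : Real.posLog ‖P.eval z‖ ≤ Real.posLog ‖P.leadingCoeff‖ +
        (s.map fun v => Real.log 2 + Real.posLog ‖z‖ + Real.posLog ‖v‖).sum := by
      rw [h]
      refine Real.posLog_mul.trans (add_le_add le_rfl ((posLog_multiset_prod_le _).trans ?_))
      rw [Multiset.map_map]
      exact Multiset.sum_map_le_sum_map _ _ fun v _ => posLog_norm_sub_le z v
    rw [hsum] at h1
    linarith

/-- The `n`-th approximation of the Green function of a polynomial. -/
noncomputable def greenApprox (P : ℂ[X]) (n : ℕ) (z : ℂ) : ℝ :=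
  ((P.natDegree : ℝ) ^ n)⁻¹ * Real.posLog ‖(iter P n).eval z‖

theorem continuous_greenApprox (P : ℂ[X]) (n : ℕ) : Continuous (greenApprox P n) :=
  continuous_const.mul (Real.continuous_posLog.comp (iter P n).continuous.norm)

/-- The previous estimate at the point `Pⁿ(z)`, divided by `d ^ (n + 1)`. -/
theorem exists_abs_greenApprox_succ_sub_le {P : ℂ[X]} (hP : 0 < P.natDegree) :
    ∃ K, ∀ n z, |greenApprox P (n + 1) z - greenApprox P n z| ≤
      K * ((P.natDegree : ℝ)⁻¹) ^ n := by
  obtain ⟨K, hK⟩ := exists_abs_posLog_eval_sub_le hP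
  refine ⟨(P.natDegree : ℝ)⁻¹ * K, fun n z => ?_⟩
  have hd : (P.natDegree : ℝ) ≠ 0 := by positivity
  have : greenApprox P (n + 1) z - greenApprox P n z = ((P.natDegree : ℝ)⁻¹) ^ (n + 1) *
      (Real.posLog ‖P.eval ((iter P n).eval z)‖ -
        P.natDegree * Real.posLog ‖(iter P n).eval z‖) := by
    rw [greenApprox, greenApprox, eval_iter_succ, inv_pow, pow_succ]
    field_simp
  rw [this, abs_mul, abs_of_nonneg (by positivity), pow_succ]
  calc _ ≤ ((P.natDegree : ℝ)⁻¹) ^ n * (P.natDegree : ℝ)⁻¹ * K := by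
        gcongr; exact hK _
    _ = _ := by ring

/-- For fixed `x`, the difference is bounded except for the logarithmic pole at `t = x`. -/
theorem abs_log_norm_sub_sub_posLog_le (t x : ℂ) :
    |Real.log ‖t - x‖ - Real.posLog ‖t‖| ≤
      max 0 (-Real.log ‖t - x‖) + (Real.log 2 + Real.posLog ‖x‖) := by
  have h1 := posLog_norm_sub_le t x
  have h2 := posLog_norm_sub_le (t - x) (-x)
  rw [sub_neg_eq_add, sub_add_cancel, norm_neg] at h2
  have h3 : Real.posLog ‖t - x‖ = Real.log ‖t - x‖ + max 0 (-Real.log ‖t - x‖) := by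
    rw [Real.posLog_apply, ← max_add_add_left]
    simp [max_comm]
  have h4 : 0 ≤ max 0 (-Real.log ‖t - x‖) := le_max_left _ _
  rw [abs_le]
  constructor <;> linarith

/-- For `q < d` the first two error terms tend to zero uniformly in `w`; the last one is small only
after integration. -/
theorem abs_log_sub_greenApprox_le {Q : ℂ[X]} (hQ : 0 < Q.natDegree) {Y : Set ℂ} {q : ℕ} {K : ℝ}
    (hq : 0 < q) (hK : 1 ≤ K) (hY : ∀ v, Q.eval v ∈ Y → v ∈ Y)
    (h : ∀ y ∈ Y, ∀ w, ∃ v, Q.eval v = y ∧ ‖w - v‖ ^ q ≤ K * ‖Q.eval w - y‖) (n : ℕ)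
    {y : ℂ} (hy : y ∈ Y) {w : ℂ} (hw : (iter Q n).eval w ≠ y) :
    |((Q.natDegree : ℝ) ^ n)⁻¹ * Real.log ‖(iter Q n).eval w - y‖ - greenApprox Q n w| ≤
      ((Q.natDegree : ℝ)⁻¹) ^ n * (Real.log 2 + Real.posLog ‖y‖) +
      ((q : ℝ) / Q.natDegree) ^ n * (n * (Real.log K + Real.log Q.natDegree)) +
      ((q : ℝ) / Q.natDegree) ^ n * (((Q.natDegree : ℝ) ^ n)⁻¹ *
        ((iter Q n - C y).roots.map fun v => ‖w - v‖⁻¹).sum) := by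
  have h1 := neg_log_norm_iter_sub_le hQ hq hK hY h n hy hw
  have h0 : 0 ≤ (q : ℝ) ^ n * (n * (Real.log K + Real.log Q.natDegree) +
      ((Q.natDegree : ℝ) ^ n)⁻¹ * ((iter Q n - C y).roots.map fun v => ‖w - v‖⁻¹).sum) := by
    have := Real.log_nonneg hK
    have := Real.log_natCast_nonneg Q.natDegree
    have : 0 ≤ ((iter Q n - C y).roots.map fun v => ‖w - v‖⁻¹).sum :=
      Multiset.sum_nonneg fun x hx => by
        obtain ⟨v, -, rfl⟩ := Multiset.mem_map.1 hx
        positivity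
    positivity
  have h2 := abs_log_norm_sub_sub_posLog_le ((iter Q n).eval w) y
  rw [greenApprox, ← mul_sub, abs_mul, abs_of_nonneg (by positivity)]
  calc _ ≤ ((Q.natDegree : ℝ) ^ n)⁻¹ * ((q : ℝ) ^ n * (n * (Real.log K + Real.log Q.natDegree) +
      ((Q.natDegree : ℝ) ^ n)⁻¹ * ((iter Q n - C y).roots.map fun v => ‖w - v‖⁻¹).sum) +
      (Real.log 2 + Real.posLog ‖y‖)) := by
        gcongr
        exact h2.trans (add_le_add (max_le h0 h1) le_rfl)
    _ = _ := by rw [div_pow, inv_pow, div_eq_mul_inv]; ring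

/-! ### A radial bump function with explicit logarithmic potential -/

/-- The difference of the logarithmic potentials of the uniform measures on the circles of
radii `2 r` and `r` around the origin. -/
noncomputable def bump (r : ℝ) (b : ℂ) : ℝ :=
  Real.log 2 + Real.posLog ((2 * r)⁻¹ * ‖b‖) - Real.posLog (r⁻¹ * ‖b‖)

theorem continuous_bump (r : ℝ) : Continuous (bump r) := by
  unfold bump; fun_prop

theorem bump_nonneg {r : ℝ} (hr : 0 < r) (b : ℂ) : 0 ≤ bump r b := by
  have h := Real.posLog_mul (x := 2) (y := (2 * r)⁻¹ * ‖b‖)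
  rw [show 2 * ((2 * r)⁻¹ * ‖b‖) = r⁻¹ * ‖b‖ by field_simp,
    Real.posLog_eq_log (x := 2) (by norm_num)] at h
  rw [bump]; linarith

theorem bump_eq_zero {r : ℝ} (hr : 0 < r) {b : ℂ} (hb : 2 * r ≤ ‖b‖) : bump r b = 0 := by
  have hb0 : 0 < ‖b‖ := by linarith
  have h1 : 1 ≤ (2 * r)⁻¹ * ‖b‖ := by
    rw [← div_eq_inv_mul, one_le_div (by positivity)]; exact hb
  have h2 : r⁻¹ * ‖b‖ = 2 * ((2 * r)⁻¹ * ‖b‖) := by field_simp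
  rw [bump, h2, Real.posLog_eq_log (by rw [abs_of_nonneg (by positivity)]; exact h1),
    Real.posLog_eq_log (by rw [abs_of_nonneg (by positivity)]; linarith),
    Real.log_mul two_ne_zero (by positivity : (2 * r)⁻¹ * ‖b‖ ≠ 0), sub_self]

theorem hasCompactSupport_bump {r : ℝ} (hr : 0 < r) : HasCompactSupport (bump r) :=
  HasCompactSupport.intro (isCompact_closedBall (0 : ℂ) (2 * r)) fun b hb =>
    bump_eq_zero hr (by simpa using (not_le.1 (mt mem_closedBall_zero_iff.2 hb)).le)

theorem integral_bump_pos {r : ℝ} (hr : 0 < r) : 0 < ∫ b, bump r b :=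
  (continuous_bump r).integral_pos_of_hasCompactSupport_nonneg_nonzero (hasCompactSupport_bump hr)
    (bump_nonneg hr) (x := 0) (by simpa [bump] using (Real.log_pos one_lt_two).ne')

/-! ### Circle averages of logarithmic potentials -/

theorem circleIntegrable_sum_log (s : Multiset ℂ) (c : ℂ) (R : ℝ) :
    CircleIntegrable (fun w => (s.map fun v => Real.log ‖w - v‖).sum) c R := by
  induction s using Multiset.induction with
  | empty => simp
  | cons v s ih =>
    simp only [Multiset.map_cons, Multiset.sum_cons]
    exact (circleIntegrable_log_norm_sub_const R).add ih

/-- The average of `log ‖· - v‖` over the circle of radius `R` about `a` is `log R + log⁺ (R⁻¹ ‖a -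
v‖)`; subtract the values at `R = r` from those at `R = 2 r`. -/
theorem sum_bump_eq_circleAverage {r : ℝ} (hr : 0 < r) (s : Multiset ℂ) (a : ℂ) :
    (s.map fun v => bump r (a - v)).sum =
      Real.circleAverage (fun w => (s.map fun v => Real.log ‖w - v‖).sum) a (2 * r) -
      Real.circleAverage (fun w => (s.map fun v => Real.log ‖w - v‖).sum) a r := by
  induction s using Multiset.induction with
  | empty => simp [Real.circleAverage_const]
  | cons v s ih =>
    simp only [Multiset.map_cons, Multiset.sum_cons]
    rw [Real.circleAverage_fun_add (circleIntegrable_log_norm_sub_const _)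
      (circleIntegrable_sum_log s a _), Real.circleAverage_fun_add
      (circleIntegrable_log_norm_sub_const _) (circleIntegrable_sum_log s a _), ih,
      circleAverage_log_norm_sub_const_eq_log_radius_add_posLog (by positivity),
      circleAverage_log_norm_sub_const_eq_log_radius_add_posLog hr.ne', bump,
      Real.log_mul (by norm_num) hr.ne']
    ring

theorem continuous_circleAverage_center {g : ℂ → ℝ} (hg : Continuous g) (R : ℝ) :
    Continuous fun a => Real.circleAverage g a R := by
  have h : Continuous fun a => ∫ θ in (0 : ℝ)..2 * Real.pi, g (circleMap a R θ) := by
    refine intervalIntegral.continuous_parametric_intervalIntegral_of_continuous' ?_ _ _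
    simp only [Function.uncurry_def, circleMap]
    fun_prop
  exact h.const_smul (2 * Real.pi)⁻¹

/-- A circle average is a mean of translates by vectors of norm `|R|`, so Tonelli and translation
invariance apply. -/
theorem lintegral_enorm_circleAverage_le {F : ℂ → ℝ} (hF : Measurable F) (ρ R : ℝ) :
    ∫⁻ a in Metric.closedBall (0 : ℂ) ρ, ‖Real.circleAverage F a R‖ₑ ≤
      ∫⁻ w in Metric.closedBall (0 : ℂ) (ρ + |R|), ‖F w‖ₑ := by
  have hπ := Real.two_pi_pos
  have hmeas : Measurable fun p : ℂ × ℝ => ‖F (circleMap p.1 R p.2)‖ₑ := by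
    refine (hF.comp ?_).enorm
    simp only [circleMap]
    fun_prop
  have htrans : ∀ θ, ∫⁻ a in Metric.closedBall (0 : ℂ) ρ, ‖F (circleMap a R θ)‖ₑ ≤
      ∫⁻ w in Metric.closedBall (0 : ℂ) (ρ + |R|), ‖F w‖ₑ := by
    intro θ
    rw [← lintegral_indicator measurableSet_closedBall,
      ← lintegral_indicator measurableSet_closedBall,
      ← lintegral_add_right_eq_self (μ := (volume : Measure ℂ))
        ((Metric.closedBall (0 : ℂ) (ρ + |R|)).indicator fun w => ‖F w‖ₑ) (circleMap 0 R θ)]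
    refine lintegral_mono fun a => ?_
    by_cases ha : a ∈ Metric.closedBall (0 : ℂ) ρ
    · have ha' : a + circleMap 0 R θ ∈ Metric.closedBall (0 : ℂ) (ρ + |R|) := by
        rw [mem_closedBall_zero_iff] at ha ⊢
        refine (norm_add_le _ _).trans (add_le_add ha ?_)
        simp
      simp only [Set.indicator_of_mem ha, Set.indicator_of_mem ha']
      simp [circleMap]
    · simp [Set.indicator_of_notMem ha]
  calc ∫⁻ a in Metric.closedBall (0 : ℂ) ρ, ‖Real.circleAverage F a R‖ₑ
      ≤ ∫⁻ a in Metric.closedBall (0 : ℂ) ρ, ENNReal.ofReal (2 * Real.pi)⁻¹ *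
          ∫⁻ θ in Set.Ioc 0 (2 * Real.pi), ‖F (circleMap a R θ)‖ₑ := by
        refine lintegral_mono fun a => ?_
        rw [Real.circleAverage_def, enorm_smul, intervalIntegral.integral_of_le hπ.le,
          Real.enorm_of_nonneg (by positivity)]
        gcongr
        exact enorm_integral_le_lintegral_enorm _
    _ = ENNReal.ofReal (2 * Real.pi)⁻¹ * ∫⁻ θ in Set.Ioc 0 (2 * Real.pi),
          ∫⁻ a in Metric.closedBall (0 : ℂ) ρ, ‖F (circleMap a R θ)‖ₑ := by
        rw [lintegral_const_mul _ hmeas.lintegral_prod_right', lintegral_lintegral_swap]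
        exact hmeas.aemeasurable
    _ ≤ ENNReal.ofReal (2 * Real.pi)⁻¹ * ∫⁻ θ in Set.Ioc 0 (2 * Real.pi),
          ∫⁻ w in Metric.closedBall (0 : ℂ) (ρ + |R|), ‖F w‖ₑ := by
        exact mul_le_mul' le_rfl (lintegral_mono fun θ => htrans θ)
    _ = _ := by
        rw [setLIntegral_const, Real.volume_Ioc, sub_zero, mul_comm, mul_assoc,
          ← ENNReal.ofReal_mul hπ.le, mul_inv_cancel₀ hπ.ne', ENNReal.ofReal_one, mul_one]

/-- If the normalized potential `κ ∑ log |w - v| + c` of a finite set is close to `g` in `L¹`, then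
averages of bumps over the finite set are close to differences of circle averages of `g`. -/
theorem enorm_sum_integral_bump_sub_le {r : ℝ} (hr : 0 < r) (s : Multiset ℂ) (κ c : ℝ)
    {g : ℂ → ℝ} (hg : Continuous g) {f : ℂ → ℝ} (hf : Continuous f) {ρ M : ℝ}
    (hρ : ∀ a, ρ < ‖a‖ → f a = 0) (hM : ∀ a, |f a| ≤ M) :
    ‖κ * (s.map fun v => ∫ a, f a * bump r (a - v)).sum -
        ∫ a, f a * (Real.circleAverage g a (2 * r) - Real.circleAverage g a r)‖ₑ ≤
      ENNReal.ofReal M * (2 * ∫⁻ w in Metric.closedBall (0 : ℂ) (ρ + 2 * r),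
        ‖κ * (s.map fun v => Real.log ‖w - v‖).sum + c - g w‖ₑ) := by
  have hfc : HasCompactSupport f := HasCompactSupport.intro (isCompact_closedBall (0 : ℂ) ρ)
    fun a ha => hρ a (not_le.1 (mt mem_closedBall_zero_iff.2 ha))
  set F : ℂ → ℝ := fun w => κ * (s.map fun v => Real.log ‖w - v‖).sum + c - g w with hFdef
  have hSm : Measurable fun w : ℂ => (s.map fun v => Real.log ‖w - v‖).sum := by
    induction s using Multiset.induction with
    | empty => simp
    | cons v s ih =>
      simp only [Multiset.map_cons, Multiset.sum_cons]
      exact (Real.measurable_log.comp (measurable_id.sub_const v).norm).add (ih rfl)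
  have hFm : Measurable F := ((hSm.const_mul κ).add_const c).sub hg.measurable
  have hgi : ∀ a R, CircleIntegrable g a R := fun a R =>
    (hg.comp (continuous_circleMap a R)).intervalIntegrable _ _
  have havg : ∀ a R, Real.circleAverage F a R =
      κ * Real.circleAverage (fun w => (s.map fun v => Real.log ‖w - v‖).sum) a R + c -
        Real.circleAverage g a R := by
    intro a R
    have h1 : CircleIntegrable (fun w => κ * (s.map fun v => Real.log ‖w - v‖).sum) a R :=
      (circleIntegrable_sum_log s a R).const_smul (a := κ)
    have h2 : CircleIntegrable (fun w => κ * (s.map fun v => Real.log ‖w - v‖).sum + c) a R :=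
      h1.add (circleIntegrable_const c a R)
    rw [hFdef, Real.circleAverage_fun_sub h2 (hgi a R), Real.circleAverage_fun_add h1 (circleIntegrable_const c a R), Real.circleAverage_const]
    have := Real.circleAverage_fun_smul (a := κ) (c := a) (R := R)
      (f := fun w => (s.map fun v => Real.log ‖w - v‖).sum)
    simp only [smul_eq_mul] at this
    rw [this]
  have hint : ∀ v, Integrable fun a => f a * bump r (a - v) := fun v =>
    (hf.mul ((continuous_bump r).comp (continuous_id.sub continuous_const))).integrable_of_hasCompactSupport
      hfc.mul_right
  have hsum : (s.map fun v => ∫ a, f a * bump r (a - v)).sum =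
      ∫ a, f a * (s.map fun v => bump r (a - v)).sum ∧
      Integrable fun a => f a * (s.map fun v => bump r (a - v)).sum := by
    clear havg hFm hSm hFdef F
    induction s using Multiset.induction with
    | empty => simp
    | cons v s ih =>
      simp only [Multiset.map_cons, Multiset.sum_cons, mul_add]
      have := ih
      rw [integral_add (hint v) this.2, this.1]
      exact ⟨rfl, (hint v).add this.2⟩
  have hgI : Integrable fun a =>
      f a * (Real.circleAverage g a (2 * r) - Real.circleAverage g a r) :=
    (hf.mul ((continuous_circleAverage_center hg _).sub
      (continuous_circleAverage_center hg _))).integrable_of_hasCompactSupport hfc.mul_right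
  -- The constant `c` cancels between the two radii, so the leading coefficient of the iterate plays
  -- no role.
  have hkey : κ * (s.map fun v => ∫ a, f a * bump r (a - v)).sum -
        ∫ a, f a * (Real.circleAverage g a (2 * r) - Real.circleAverage g a r) =
      ∫ a, f a * (Real.circleAverage F a (2 * r) - Real.circleAverage F a r) := by
    rw [hsum.1, ← integral_const_mul, ← integral_sub (hsum.2.const_mul κ) hgI]
    refine integral_congr_ae (ae_of_all _ fun a => ?_)
    simp only [sum_bump_eq_circleAverage hr, havg]
    ring
  have hball : ∀ R, 0 < R → R ≤ 2 * r →
      ∫⁻ a in Metric.closedBall (0 : ℂ) ρ, ‖Real.circleAverage F a R‖ₑ ≤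
      ∫⁻ w in Metric.closedBall (0 : ℂ) (ρ + 2 * r), ‖F w‖ₑ := by
    intro R hR hR'
    refine (lintegral_enorm_circleAverage_le hFm ρ R).trans (lintegral_mono_set ?_)
    rw [abs_of_pos hR]
    exact Metric.closedBall_subset_closedBall (by linarith)
  rw [hkey]
  refine (enorm_integral_le_lintegral_enorm _).trans ?_
  have hMe : ∀ a, ‖f a‖ₑ ≤ ENNReal.ofReal M := fun a => by
    rw [Real.enorm_eq_ofReal_abs]; exact ENNReal.ofReal_le_ofReal (hM a)
  have hFa : ∀ R, AEMeasurable (fun a => ‖Real.circleAverage F a R‖ₑ)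
      (volume.restrict (Metric.closedBall (0 : ℂ) ρ)) := by
    intro R
    have : StronglyMeasurable fun a => Real.circleAverage F a R := by
      have h2 : StronglyMeasurable fun p : ℂ × ℝ => F (circleMap p.1 R p.2) := by
        refine (hFm.comp ?_).stronglyMeasurable
        simp only [circleMap]
        fun_prop
      simp only [Real.circleAverage_def, intervalIntegral.integral_of_le Real.two_pi_pos.le]
      exact (h2.integral_prod_right' (ν := volume.restrict _)).const_smul (2 * Real.pi)⁻¹
    exact this.measurable.enorm.aemeasurable
  calc ∫⁻ a, ‖f a * (Real.circleAverage F a (2 * r) - Real.circleAverage F a r)‖ₑ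
      ≤ ∫⁻ a in Metric.closedBall (0 : ℂ) ρ, ENNReal.ofReal M *
          (‖Real.circleAverage F a (2 * r)‖ₑ + ‖Real.circleAverage F a r‖ₑ) := by
        rw [← lintegral_indicator measurableSet_closedBall]
        refine lintegral_mono fun a => ?_
        by_cases ha : a ∈ Metric.closedBall (0 : ℂ) ρ
        · rw [Set.indicator_of_mem ha, enorm_mul]
          exact mul_le_mul' (hMe a) enorm_sub_le
        · simp [hρ a (not_le.1 (mt mem_closedBall_zero_iff.2 ha))]
    _ ≤ _ := by
        rw [lintegral_const_mul' _ _ ENNReal.ofReal_ne_top, lintegral_add_left' (hFa _),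
          two_mul (∫⁻ _ in _, _)]
        exact mul_le_mul' le_rfl
          (add_le_add (hball _ (by positivity) le_rfl) (hball _ hr (by linarith)))

/-- The normalized bumps are an approximate identity: `bump r` vanishes outside radius `2 r = δ`,
where `δ` comes from the uniform continuity of `f`. -/
theorem exists_abs_integral_bump_sub_le {f : ℂ → ℝ} (hf : Continuous f)
    (hfc : HasCompactSupport f) {η : ℝ} (hη : 0 < η) :
    ∃ r > 0, ∀ v, |(∫ b, bump r b)⁻¹ * (∫ a, f a * bump r (a - v)) - f v| ≤ η := by
  obtain ⟨δ, hδ, hu⟩ := Metric.uniformContinuous_iff.1 (hfc.uniformContinuous_of_continuous hf)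
    η hη
  have hr : 0 < δ / 2 := by positivity
  refine ⟨δ / 2, hr, fun v => ?_⟩
  set r := δ / 2 with hrdef
  have hpos := integral_bump_pos hr
  have hbi : Integrable fun a => bump r (a - v) :=
    ((continuous_bump r).integrable_of_hasCompactSupport (hasCompactSupport_bump hr)).comp_sub_right v
  have hbe : ∫ a, bump r (a - v) = ∫ b, bump r b := integral_sub_right_eq_self _ v
  have hfi : Integrable fun a => f a * bump r (a - v) :=
    (hf.mul ((continuous_bump r).comp (continuous_id.sub continuous_const))).integrable_of_hasCompactSupport
      hfc.mul_right
  have h1 : (∫ b, bump r b)⁻¹ * (∫ a, f a * bump r (a - v)) - f v =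
      (∫ b, bump r b)⁻¹ * ∫ a, (f a - f v) * bump r (a - v) := by
    simp only [sub_mul]
    rw [integral_sub hfi (hbi.const_mul _), integral_const_mul, hbe]
    field_simp
  rw [h1, abs_mul, abs_of_pos (inv_pos.2 hpos), inv_mul_le_iff₀ hpos]
  calc |∫ a, (f a - f v) * bump r (a - v)| ≤ ∫ a, η * bump r (a - v) := by
        rw [← Real.norm_eq_abs]
        refine norm_integral_le_of_norm_le (hbi.const_mul η) (ae_of_all _ fun a => ?_)
        rw [norm_mul, Real.norm_of_nonneg (bump_nonneg hr _)]
        rcases le_or_gt (2 * r) ‖a - v‖ with h | h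
        · simp [bump_eq_zero hr h]
        · refine mul_le_mul_of_nonneg_right ?_ (bump_nonneg hr _)
          exact (hu (by rw [dist_eq_norm]; linarith)).le
    _ = (∫ b, bump r b) * η := by rw [integral_const_mul, hbe, mul_comm]

/-! ### Uniform local integrability of the inverse distance -/

/-- In polar coordinates the Jacobian cancels the singularity. -/
theorem lintegral_inv_norm_ball_lt_top :
    ∫⁻ w in Metric.ball (0 : ℂ) 1, ENNReal.ofReal ‖w‖⁻¹ < ⊤ := by
  rw [← lintegral_indicator measurableSet_ball, ← Complex.lintegral_comp_polarCoord_symm]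
  calc _ ≤ ∫⁻ p in Set.Ioo (0 : ℝ) 1 ×ˢ Set.Ioo (-Real.pi) Real.pi, 1 := by
        rw [← lintegral_indicator polarCoord.open_target.measurableSet,
          ← lintegral_indicator (measurableSet_Ioo.prod measurableSet_Ioo)]
        refine lintegral_mono fun p => ?_
        by_cases hp : p ∈ polarCoord.target
        · rw [Set.indicator_of_mem hp]
          rw [polarCoord_target] at hp
          have hp0 : 0 < p.1 := hp.1
          by_cases h1 : p.1 < 1
          · rw [Set.indicator_of_mem (s := Metric.ball _ _) (by
              rw [mem_ball_zero_iff, Complex.norm_polarCoord_symm, abs_of_pos hp0]; exact h1),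
              Set.indicator_of_mem (show p ∈ Set.Ioo (0 : ℝ) 1 ×ˢ Set.Ioo (-Real.pi) Real.pi from
                ⟨⟨hp0, h1⟩, hp.2⟩),
              Complex.norm_polarCoord_symm, abs_of_pos hp0, smul_eq_mul,
              ← ENNReal.ofReal_mul hp0.le, mul_inv_cancel₀ hp0.ne']
            simp
          · rw [Set.indicator_of_notMem (s := Metric.ball _ _)]
            · simp
            · rw [mem_ball_zero_iff, Complex.norm_polarCoord_symm, abs_of_pos hp0]; exact h1
        · rw [Set.indicator_of_notMem hp]; exact bot_le
    _ < ⊤ := by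
        rw [setLIntegral_one, Measure.volume_eq_prod, Measure.prod_prod, Real.volume_Ioo,
          Real.volume_Ioo]
        exact ENNReal.mul_lt_top ENNReal.ofReal_lt_top ENNReal.ofReal_lt_top

/-- The integrand is at most one outside the unit disc about `v`, and translation invariance bounds
the rest. Uniformity in `v` matters because nothing is known about where the preimages lie. -/
theorem exists_lintegral_inv_norm_sub_le (ρ : ℝ) : ∃ K : ℝ≥0∞, K ≠ ⊤ ∧
    ∀ v : ℂ, ∫⁻ w in Metric.closedBall (0 : ℂ) ρ, ENNReal.ofReal ‖w - v‖⁻¹ ≤ K := by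
  refine ⟨volume (Metric.closedBall (0 : ℂ) ρ) +
    ∫⁻ w in Metric.ball (0 : ℂ) 1, ENNReal.ofReal ‖w‖⁻¹,
    ENNReal.add_ne_top.2 ⟨measure_closedBall_lt_top.ne, lintegral_inv_norm_ball_lt_top.ne⟩,
    fun v => ?_⟩
  calc ∫⁻ w in Metric.closedBall (0 : ℂ) ρ, ENNReal.ofReal ‖w - v‖⁻¹
      ≤ ∫⁻ w in Metric.closedBall (0 : ℂ) ρ, (1 + (Metric.ball (0 : ℂ) 1).indicator
          (fun w => ENNReal.ofReal ‖w‖⁻¹) (w - v)) := by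
        refine lintegral_mono fun w => ?_
        by_cases h : w - v ∈ Metric.ball (0 : ℂ) 1
        · rw [Set.indicator_of_mem h]
          exact le_add_self
        · rw [Set.indicator_of_notMem h, add_zero]
          rw [mem_ball_zero_iff, not_lt] at h
          exact ENNReal.ofReal_le_one.2 (inv_le_one_of_one_le₀ h)
    _ ≤ _ := by
        rw [lintegral_add_left measurable_const, setLIntegral_one]
        refine add_le_add le_rfl ((setLIntegral_le_lintegral _ _).trans ?_)
        rw [lintegral_sub_right_eq_self (μ := (volume : Measure ℂ))
          ((Metric.ball (0 : ℂ) 1).indicator fun w => ENNReal.ofReal ‖w‖⁻¹) v,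
          lintegral_indicator measurableSet_ball]

/-! ### Equidistribution of iterated preimages -/

/-- The average of a function over the fibre of a polynomial, with multiplicities. -/
noncomputable def rootAvg (Q : ℂ[X]) (f : ℂ → ℝ) (y : ℂ) : ℝ :=
  (Q.natDegree : ℝ)⁻¹ * ((Q - C y).roots.map f).sum

theorem abs_rootAvg_sub_le {Q : ℂ[X]} (hQ : 0 < Q.natDegree) {f g : ℂ → ℝ} {η : ℝ} (y : ℂ)
    (h : ∀ v, Q.eval v = y → |f v - g v| ≤ η) : |rootAvg Q f y - rootAvg Q g y| ≤ η := by
  have hd : (0 : ℝ) < Q.natDegree := by exact_mod_cast hQ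
  rw [rootAvg, rootAvg, ← mul_sub, ← Multiset.sum_map_sub, abs_mul, abs_of_pos (inv_pos.2 hd),
    inv_mul_le_iff₀ hd, ← card_roots_sub_C Q y, ← nsmul_eq_mul]
  refine (Multiset.abs_sum_le_sum_abs).trans ?_
  rw [Multiset.map_map, ← Multiset.card_map (fun v => |f v - g v|)]
  refine Multiset.sum_le_card_nsmul _ _ fun x hx => ?_
  obtain ⟨v, hv, rfl⟩ := Multiset.mem_map.1 hx
  exact h v ((mem_roots_sub_C_iff hQ).1 hv)

theorem lintegral_sum_inv_norm_sub_le {ρ : ℝ} {K : ℝ≥0∞}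
    (hK : ∀ v : ℂ, ∫⁻ w in Metric.closedBall (0 : ℂ) ρ, ENNReal.ofReal ‖w - v‖⁻¹ ≤ K)
    (s : Multiset ℂ) :
    ∫⁻ w in Metric.closedBall (0 : ℂ) ρ, ENNReal.ofReal (s.map fun v => ‖w - v‖⁻¹).sum ≤
      s.card * K := by
  induction s using Multiset.induction with
  | empty => simp
  | cons v s ih =>
    simp only [Multiset.map_cons, Multiset.sum_cons, Multiset.card_cons]
    calc _ ≤ ∫⁻ w in Metric.closedBall (0 : ℂ) ρ, (ENNReal.ofReal ‖w - v‖⁻¹ +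
          ENNReal.ofReal (s.map fun v => ‖w - v‖⁻¹).sum) :=
          lintegral_mono fun w => ENNReal.ofReal_add_le
      _ ≤ _ := by
          rw [lintegral_add_left (by fun_prop), Nat.cast_succ, add_mul, one_mul, add_comm]
          exact add_le_add ih (hK v)

/-- The inverse distances to the `dⁿ` roots, divided by `dⁿ`, have bounded integral, so the factor
`(q / d)ⁿ` wins. -/
theorem tendsto_lintegral_log_sub_greenApprox {Q : ℂ[X]} {Y : Set ℂ} {q : ℕ} {K : ℝ}
    (hq : 0 < q) (hqQ : q < Q.natDegree) (hK : 1 ≤ K) (hY : ∀ v, Q.eval v ∈ Y → v ∈ Y)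
    (h : ∀ y ∈ Y, ∀ w, ∃ v, Q.eval v = y ∧ ‖w - v‖ ^ q ≤ K * ‖Q.eval w - y‖)
    {y : ℂ} (hy : y ∈ Y) (ρ : ℝ) :
    Tendsto (fun n => ∫⁻ w in Metric.closedBall (0 : ℂ) ρ,
      ‖((Q.natDegree : ℝ) ^ n)⁻¹ * ((iter Q n - C y).roots.map fun v => Real.log ‖w - v‖).sum +
        ((Q.natDegree : ℝ) ^ n)⁻¹ * Real.log ‖(iter Q n).leadingCoeff‖ - greenApprox Q n w‖ₑ)
      atTop (𝓝 0) := by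
  have hQ : 0 < Q.natDegree := hq.trans hqQ
  have hd : (0 : ℝ) < Q.natDegree := by exact_mod_cast hQ
  obtain ⟨K', hK', hK'v⟩ := exists_lintegral_inv_norm_sub_le ρ
  set A := Real.log 2 + Real.posLog ‖y‖
  set B := Real.log K + Real.log Q.natDegree
  set t := (q : ℝ) / Q.natDegree
  set e : ℕ → ℝ := fun n => ((Q.natDegree : ℝ)⁻¹) ^ n * A + t ^ n * (n * B)
  have ht0 : 0 ≤ t := by positivity
  have ht1 : t < 1 := (div_lt_one hd).2 (by exact_mod_cast hqQ)
  have hi1 : (Q.natDegree : ℝ)⁻¹ < 1 := inv_lt_one_of_one_lt₀ (by exact_mod_cast by omega)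
  have he : Tendsto e atTop (𝓝 0) := by
    have h1 := (tendsto_pow_atTop_nhds_zero_of_lt_one (inv_nonneg.2 hd.le) hi1).mul_const A
    have h2 := (tendsto_self_mul_const_pow_of_lt_one ht0 ht1).mul_const B
    simp only [zero_mul] at h1 h2
    have := h1.add h2
    rw [add_zero] at this
    exact this.congr fun n => by simp only [e]; ring
  have hlim : Tendsto (fun n => ENNReal.ofReal (e n) * volume (Metric.closedBall (0 : ℂ) ρ) +
      ENNReal.ofReal (t ^ n) * K') atTop (𝓝 0) := by
    have h1 := ENNReal.Tendsto.mul_const (ENNReal.tendsto_ofReal he)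
      (Or.inr (measure_closedBall_lt_top (μ := volume) (x := (0 : ℂ)) (r := ρ)).ne)
    have h2 := ENNReal.Tendsto.mul_const (ENNReal.tendsto_ofReal
      (tendsto_pow_atTop_nhds_zero_of_lt_one ht0 ht1)) (Or.inr hK')
    simpa using h1.add h2
  refine tendsto_of_tendsto_of_tendsto_of_le_of_le tendsto_const_nhds hlim
    (fun n => bot_le) fun n => ?_
  have hQn := natDegree_iter_pos hQ n
  -- The pointwise estimate is available only off the fibre, which is finite, hence null.
  have hfin : {w : ℂ | (iter Q n).eval w = y}.Finite :=
    ((iter Q n - C y).roots.toFinset.finite_toSet).subset fun w hw => by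
      simpa using (mem_roots_sub_C_iff hQn).2 hw
  have hae : ∀ᵐ w ∂(volume.restrict (Metric.closedBall (0 : ℂ) ρ)), (iter Q n).eval w ≠ y :=
    ae_restrict_of_ae (hfin.measure_zero volume |> fun h0 => measure_eq_zero_iff_ae_notMem.1 h0)
  calc _ ≤ ∫⁻ w in Metric.closedBall (0 : ℂ) ρ, (ENNReal.ofReal (e n) +
        ENNReal.ofReal (t ^ n * ((Q.natDegree : ℝ) ^ n)⁻¹) *
          ENNReal.ofReal ((iter Q n - C y).roots.map fun v => ‖w - v‖⁻¹).sum) := by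
        refine lintegral_mono_ae (hae.mono fun w hw => ?_)
        have h1 := abs_log_sub_greenApprox_le hQ hq hK hY h n hy hw
        rw [log_norm_eval_sub hQn hw, mul_add, add_comm (_ * _) (_ * _)] at h1
        rw [Real.enorm_eq_ofReal_abs, ← ENNReal.ofReal_mul (by positivity)]
        refine (ENNReal.ofReal_le_ofReal (h1.trans_eq ?_)).trans ENNReal.ofReal_add_le
        simp only [e, A, B, t]
        ring
    _ ≤ _ := by
        rw [lintegral_add_left measurable_const, setLIntegral_const,
          lintegral_const_mul' _ _ ENNReal.ofReal_ne_top]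
        refine add_le_add le_rfl ?_
        refine (mul_le_mul' le_rfl (lintegral_sum_inv_norm_sub_le hK'v _)).trans_eq ?_
        rw [card_roots_sub_C, natDegree_iter, ← mul_assoc, ENNReal.ofReal_mul (by positivity),
          mul_assoc (ENNReal.ofReal _), ← ENNReal.ofReal_natCast, ← ENNReal.ofReal_mul (by positivity),
          Nat.cast_pow, inv_mul_cancel₀ (by positivity), ENNReal.ofReal_one, mul_one]

/-- The approximate value `m` is common to all `i`; this makes each sequence Cauchy and forces all
limits to agree. It allows test functions to be replaced by approximations. -/
theorem exists_forall_tendsto_of_forall_eventually {ι : Type*} {x : ι → ℕ → ℝ}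
    (h : ∀ η > 0, ∃ m, ∀ i, ∀ᶠ n in atTop, |x i n - m| ≤ η) :
    ∃ L, ∀ i, Tendsto (x i) atTop (𝓝 L) := by
  rcases isEmpty_or_nonempty ι with hι | ⟨⟨j⟩⟩
  · exact ⟨0, fun i => (hι.false i).elim⟩
  have hc : CauchySeq (x j) := by
    rw [Metric.cauchySeq_iff']
    intro ε hε
    obtain ⟨m, hm⟩ := h (ε / 3) (by positivity)
    obtain ⟨N, hN⟩ := eventually_atTop.1 (hm j)
    refine ⟨N, fun n hn => ?_⟩
    have h1 := abs_le.1 (hN n hn)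
    have h2 := abs_le.1 (hN N le_rfl)
    rw [Real.dist_eq, abs_lt]
    constructor <;> linarith
  obtain ⟨L, hL⟩ := cauchySeq_tendsto_of_complete hc
  refine ⟨L, fun i => Metric.tendsto_nhds.2 fun ε hε => ?_⟩
  obtain ⟨m, hm⟩ := h (ε / 3) (by positivity)
  have hLm : |L - m| ≤ ε / 3 := le_of_tendsto (hL.sub_const m).abs (hm j)
  filter_upwards [hm i] with n hn
  rw [abs_le] at hn hLm
  rw [Real.dist_eq, abs_lt]
  constructor <;> linarith

/-- Circle averages and integration against `f` preserve the geometric bound on successive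
differences, so the limiting Green function need not be formed. -/
theorem cauchySeq_integral_circleAverage_greenApprox {Q : ℂ[X]} (hQ : 2 ≤ Q.natDegree)
    {f : ℂ → ℝ} (hf : Continuous f) (hfc : HasCompactSupport f) (r : ℝ) :
    CauchySeq fun n => ∫ a, f a * (Real.circleAverage (greenApprox Q n) a (2 * r) -
      Real.circleAverage (greenApprox Q n) a r) := by
  obtain ⟨K, hK⟩ := exists_abs_greenApprox_succ_sub_le (P := Q) (by omega)
  have hi : ∀ n a R, CircleIntegrable (greenApprox Q n) a R := fun n a R =>
    ((continuous_greenApprox Q n).comp (continuous_circleMap a R)).intervalIntegrable _ _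
  have havg : ∀ n a R, |Real.circleAverage (greenApprox Q (n + 1)) a R -
      Real.circleAverage (greenApprox Q n) a R| ≤ K * ((Q.natDegree : ℝ)⁻¹) ^ n := by
    intro n a R
    rw [← Real.circleAverage_sub (hi _ a R) (hi _ a R)]
    refine Real.abs_circleAverage_le_circleAverage_abs.trans ?_
    exact Real.circleAverage_mono_on_of_le_circle ((hi _ a R).sub (hi _ a R)).abs
      fun z _ => hK n z
  have hint : ∀ n, Integrable fun a => f a * (Real.circleAverage (greenApprox Q n) a (2 * r) -
      Real.circleAverage (greenApprox Q n) a r) := fun n =>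
    (hf.mul ((continuous_circleAverage_center (continuous_greenApprox Q n) _).sub
      (continuous_circleAverage_center (continuous_greenApprox Q n) _))).integrable_of_hasCompactSupport
      hfc.mul_right
  refine cauchySeq_of_le_geometric (Q.natDegree : ℝ)⁻¹ ((∫ a, |f a|) * (2 * K))
    (inv_lt_one_of_one_lt₀ (by exact_mod_cast hQ)) fun n => ?_
  rw [dist_comm, dist_eq_norm, ← integral_sub (hint _) (hint _), mul_assoc,
    ← integral_mul_const]
  refine norm_integral_le_of_norm_le
    ((hf.integrable_of_hasCompactSupport hfc).abs.mul_const _) (ae_of_all _ fun a => ?_)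
  rw [← mul_sub, norm_mul, Real.norm_eq_abs, Real.norm_eq_abs]
  refine mul_le_mul_of_nonneg_left ?_ (abs_nonneg _)
  have h1 := abs_le.1 (havg n a (2 * r))
  have h2 := abs_le.1 (havg n a r)
  rw [abs_le]
  constructor <;> linarith

/-- Equidistribution of iterated preimages for a polynomial satisfying a Łojasiewicz inequality with
exponent less than the degree over a backward invariant set. -/
theorem exists_forall_tendsto_rootAvg {Q : ℂ[X]} {Y : Set ℂ} {q : ℕ} {K : ℝ}
    (hq : 0 < q) (hqQ : q < Q.natDegree) (hK : 1 ≤ K) (hY : ∀ v, Q.eval v ∈ Y → v ∈ Y)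
    (h : ∀ y ∈ Y, ∀ w, ∃ v, Q.eval v = y ∧ ‖w - v‖ ^ q ≤ K * ‖Q.eval w - y‖)
    {f : ℂ → ℝ} (hf : Continuous f) (hfc : HasCompactSupport f) :
    ∃ L, ∀ y ∈ Y, Tendsto (fun n => rootAvg (iter Q n) f y) atTop (𝓝 L) := by
  have hQ : 0 < Q.natDegree := hq.trans hqQ
  obtain ⟨M, hM⟩ := hfc.exists_bound_of_continuous hf
  obtain ⟨ρ, hρ⟩ : ∃ ρ : ℝ, ∀ a, ρ < ‖a‖ → f a = 0 := by
    obtain ⟨ρ, hρ⟩ := hfc.isCompact.isBounded.exists_norm_le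
    exact ⟨ρ, fun a ha => image_eq_zero_of_notMem_tsupport fun h' => (hρ a h').not_gt ha⟩
  obtain ⟨L, hL⟩ := exists_forall_tendsto_of_forall_eventually (ι := Y)
    (x := fun y n => rootAvg (iter Q n) f y) (by
      intro η hη
      obtain ⟨r, hr, hfr⟩ := exists_abs_integral_bump_sub_le hf hfc (half_pos hη)
      obtain ⟨m, hm⟩ := cauchySeq_tendsto_of_complete
        (cauchySeq_integral_circleAverage_greenApprox (by omega) hf hfc r (Q := Q))
      set J := ∫ b, bump r b
      -- The limit for the smoothed test function, read off from the Green approximations and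
      -- therefore the same for every `y`.
      refine ⟨J⁻¹ * m, fun ⟨y, hy⟩ => ?_⟩
      have hdiff : Tendsto (fun n => rootAvg (iter Q n) (fun v => ∫ a, f a * bump r (a - v)) y -
          ∫ a, f a * (Real.circleAverage (greenApprox Q n) a (2 * r) -
            Real.circleAverage (greenApprox Q n) a r)) atTop (𝓝 0) := by
        rw [tendsto_zero_iff_enorm_tendsto_zero]
        have h1 := ENNReal.Tendsto.const_mul (a := ENNReal.ofReal M) (ENNReal.Tendsto.const_mul
          (a := 2) (tendsto_lintegral_log_sub_greenApprox hq hqQ hK hY h hy (ρ + 2 * r))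
          (Or.inr ENNReal.ofNat_ne_top)) (Or.inr ENNReal.ofReal_ne_top)
        rw [mul_zero, mul_zero] at h1
        refine tendsto_of_tendsto_of_tendsto_of_le_of_le tendsto_const_nhds h1
          (fun n => bot_le) fun n => ?_
        have := enorm_sum_integral_bump_sub_le hr (iter Q n - C y).roots
          (((Q.natDegree : ℝ) ^ n)⁻¹)
          (((Q.natDegree : ℝ) ^ n)⁻¹ * Real.log ‖(iter Q n).leadingCoeff‖)
          (continuous_greenApprox Q n) hf hρ hM
        rw [rootAvg, natDegree_iter, Nat.cast_pow]
        exact this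
      have hlim := ((hdiff.add hm).const_mul J⁻¹)
      rw [zero_add] at hlim
      filter_upwards [Metric.tendsto_nhds.1 hlim (η / 2) (half_pos hη)] with n hn
      have h2 := abs_rootAvg_sub_le (natDegree_iter_pos hQ n) y fun v _ => hfr v
      have h3 : rootAvg (iter Q n) (fun v => J⁻¹ * ∫ a, f a * bump r (a - v)) y =
          J⁻¹ * rootAvg (iter Q n) (fun v => ∫ a, f a * bump r (a - v)) y := by
        rw [rootAvg, rootAvg, Multiset.sum_map_mul_left]; ring
      rw [h3] at h2
      rw [sub_add_cancel, Real.dist_eq, abs_lt] at hn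
      rw [abs_le] at h2 ⊢
      constructor <;> linarith)
  exact ⟨L, fun y hy => hL ⟨y, hy⟩⟩

/-! ### Critical points and the spread of fibres -/

/-- Gauss–Lucas: `c` is a critical point of `Q - y`, so it lies in the convex hull of the fibre, and
the disc is convex. -/
theorem norm_sub_lt_of_forall_root {Q : ℂ[X]} (hQ : 0 < Q.natDegree) {y c w : ℂ} {δ : ℝ}
    (hd : Q.derivative ≠ 0) (hc : Q.derivative.eval c = 0)
    (h : ∀ v, Q.eval v = y → ‖w - v‖ < δ) : ‖w - c‖ < δ := by
  have hdeg : 0 < (Q - C y).degree := by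
    rw [← natDegree_pos_iff_degree_pos, natDegree_sub_C]; exact hQ
  have hsub : (Q - C y).rootSet ℂ ⊆ Metric.ball w δ := fun v hv => by
    rw [mem_rootSet, coe_aeval_eq_eval] at hv
    rw [mem_ball_iff_norm']
    exact h v (by simpa [sub_eq_zero] using hv.2)
  have hc' : c ∈ (Q - C y).derivative.rootSet ℂ := by
    rw [derivative_sub, derivative_C, sub_zero, mem_rootSet, coe_aeval_eq_eval]
    exact ⟨hd, hc⟩
  have := convexHull_min hsub (convex_ball w δ)
    (rootSet_derivative_subset_convexHull_rootSet hdeg hc')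
  rwa [mem_ball_iff_norm'] at this

theorem derivative_ne_zero_of_natDegree_pos {Q : ℂ[X]} (hQ : 0 < Q.natDegree) :
    Q.derivative ≠ 0 := fun h => by
  have := derivative_eq_zero.1 h
  omega

theorem exists_one_le_forall_root_pow_le {Q : ℂ[X]} (hQ : 0 < Q.natDegree) {Y : Set ℂ} {δ : ℝ}
    (hδ : 0 < δ) (h : ∀ y ∈ Y, ∀ w, ∃ v, Q.eval v = y ∧ δ ≤ ‖w - v‖) :
    ∃ K : ℝ, 1 ≤ K ∧ ∀ y ∈ Y, ∀ w, ∃ v, Q.eval v = y ∧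
      ‖w - v‖ ^ (Q.natDegree - 1) ≤ K * ‖Q.eval w - y‖ := by
  have hQ0 : Q.leadingCoeff ≠ 0 := by
    rw [Ne, leadingCoeff_eq_zero]; rintro rfl; simp at hQ
  have hpos : 0 < ‖Q.leadingCoeff‖ * δ := mul_pos (norm_pos_iff.2 hQ0) hδ
  refine ⟨max 1 (‖Q.leadingCoeff‖ * δ)⁻¹, le_max_left _ _, fun y hy w => ?_⟩
  obtain ⟨v, hv, hle⟩ := exists_root_pow_le hQ w (h y hy w)
  refine ⟨v, hv, ?_⟩
  calc ‖w - v‖ ^ (Q.natDegree - 1) ≤ (‖Q.leadingCoeff‖ * δ)⁻¹ * ‖Q.eval w - y‖ := by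
        rwa [le_inv_mul_iff₀ hpos]
    _ ≤ _ := by gcongr; exact le_max_right _ _

theorem rootAvg_comp {A B : ℂ[X]} (hA : 0 < A.natDegree) (hB : 0 < B.natDegree) (f : ℂ → ℝ)
    (y : ℂ) : rootAvg (A.comp B) f y = rootAvg A (rootAvg B f) y := by
  rw [rootAvg, roots_comp_sub_C hA hB, Multiset.map_bind, Multiset.sum_bind, natDegree_comp,
    rootAvg]
  have : ((A - C y).roots.map (rootAvg B f)).sum = (B.natDegree : ℝ)⁻¹ *
      ((A - C y).roots.map fun v => ((B - C v).roots.map f).sum).sum := by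
    rw [← Multiset.sum_map_mul_left]
    rfl
  rw [this, Nat.cast_mul, mul_inv, mul_assoc]

theorem rootAvg_const {A : ℂ[X]} (hA : 0 < A.natDegree) (L : ℝ) (y : ℂ) :
    rootAvg A (fun _ => L) y = L := by
  have : (A.natDegree : ℝ) ≠ 0 := by positivity
  rw [rootAvg, Multiset.map_const', Multiset.sum_replicate, card_roots_sub_C, nsmul_eq_mul,
    inv_mul_cancel_left₀ this]

theorem tendsto_rootAvg {A : ℂ[X]} (hA : 0 < A.natDegree) {F : ℕ → ℂ → ℝ} {L : ℝ} {y : ℂ}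
    (h : ∀ v, A.eval v = y → Tendsto (fun n => F n v) atTop (𝓝 L)) :
    Tendsto (fun n => rootAvg A (F n) y) atTop (𝓝 L) := by
  have : Tendsto (fun n => rootAvg A (F n) y) atTop (𝓝 (rootAvg A (fun _ => L) y)) :=
    (tendsto_multiset_sum (f := fun v n => F n v) (a := fun _ => L) _ fun v hv =>
    h v ((mem_roots_sub_C_iff hA).1 hv)).const_mul _
  rwa [rootAvg_const hA] at this

/-- A polynomial of degree at least two is either conjugate to a monomial by an affine map fixing
the critical point, or its second iterate has two distinct critical points. -/
theorem exists_eq_or_exists_derivative_comp_self_eq_zero {P : ℂ[X]} (hP : 2 ≤ P.natDegree) :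
    (∃ c, P = C P.leadingCoeff * (X - C c) ^ P.natDegree + C c) ∨
      ∃ c₁ c₂, c₁ ≠ c₂ ∧ (P.comp P).derivative.eval c₁ = 0 ∧
        (P.comp P).derivative.eval c₂ = 0 := by
  by_contra! hcon
  obtain ⟨hne, hcon⟩ := hcon
  have heval : ∀ z, (P.comp P).derivative.eval z =
      P.derivative.eval z * P.derivative.eval (P.eval z) := fun z => by
    rw [derivative_comp, eval_mul, eval_comp]
  obtain ⟨c, hc⟩ := IsAlgClosed.exists_root P.derivative (by
    rw [degree_eq_natDegree (derivative_ne_zero_of_natDegree_pos (by omega)),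
      natDegree_derivative]
    exact_mod_cast (by omega : P.natDegree - 1 ≠ 0))
  rw [IsRoot.def] at hc
  -- If `P z = c` with `z ≠ c`, then `z` and `c` are two critical points of `P ∘ P`, because `c` is
  -- critical for `P`.
  have hroot : ∀ z, P.eval z = c → z = c := fun z hz => by
    by_contra hzc
    exact hcon z c hzc (by rw [heval, hz, hc, mul_zero]) (by rw [heval, hc, zero_mul])
  have hrep : (P - C c).roots = Multiset.replicate P.natDegree c :=
    Multiset.eq_replicate.2 ⟨card_roots_sub_C P c, fun z hz =>
      hroot z ((mem_roots_sub_C_iff (by omega)).1 hz)⟩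
  refine hne c ?_
  have := sub_C_eq_prod (Q := P) (by omega) c
  rw [hrep, Multiset.map_replicate, Multiset.prod_replicate] at this
  exact sub_eq_iff_eq_add.1 this

/-- A disc of radius `‖c₁ - c₂‖ / 2` cannot contain both critical points, hence contains no fibre of
`P ∘ P`. This settles the even iterates over all points. -/
theorem exists_forall_tendsto_rootAvg_of_derivative {P : ℂ[X]} (hP : 2 ≤ P.natDegree) {c₁ c₂ : ℂ}
    (hc : c₁ ≠ c₂) (h₁ : (P.comp P).derivative.eval c₁ = 0)
    (h₂ : (P.comp P).derivative.eval c₂ = 0) {f : ℂ → ℝ} (hf : Continuous f)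
    (hfc : HasCompactSupport f) :
    ∃ L, ∀ y, Tendsto (fun n => rootAvg (iter P n) f y) atTop (𝓝 L) := by
  have hdeg : 4 ≤ (P.comp P).natDegree := by rw [natDegree_comp]; nlinarith
  have hder := derivative_ne_zero_of_natDegree_pos (show 0 < (P.comp P).natDegree by omega)
  obtain ⟨K, hK, hle⟩ := exists_one_le_forall_root_pow_le (Q := P.comp P) (Y := Set.univ)
    (δ := ‖c₁ - c₂‖ / 2) (by omega) (half_pos (norm_pos_iff.2 (sub_ne_zero.2 hc))) (by
      intro y _ w
      by_contra! hlt
      have b₁ := norm_sub_lt_of_forall_root (by omega) hder h₁ hlt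
      have b₂ := norm_sub_lt_of_forall_root (by omega) hder h₂ hlt
      have := norm_sub_le (w - c₂) (w - c₁)
      rw [sub_sub_sub_cancel_left] at this
      linarith)
  obtain ⟨L, hL⟩ := exists_forall_tendsto_rootAvg (Q := P.comp P) (by omega) (by omega) hK
    (fun _ _ => Set.mem_univ _) hle hf hfc
  simp only [iter_two_mul, Set.mem_univ, true_imp_iff] at hL
  refine ⟨L, fun y => ?_⟩
  -- The fibre average of an odd iterate averages those of an even iterate over the preimages of
  -- `y`, and these share the limit `L`.
  have hodd : Tendsto (fun n => rootAvg (iter P (2 * n + 1)) f y) atTop (𝓝 L) := by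
    have : ∀ n, rootAvg (iter P (2 * n + 1)) f y = rootAvg P (rootAvg (iter P (2 * n)) f) y :=
      fun n => by rw [iter_succ, rootAvg_comp (by omega) (natDegree_iter_pos (by omega) _)]
    simp only [this]
    exact tendsto_rootAvg (by omega) fun v _ => hL v
  rw [Metric.tendsto_atTop]
  intro ε hε
  obtain ⟨N₁, hN₁⟩ := Metric.tendsto_atTop.1 (hL y) ε hε
  obtain ⟨N₂, hN₂⟩ := Metric.tendsto_atTop.1 hodd ε hε
  refine ⟨2 * (N₁ + N₂) + 1, fun n hn => ?_⟩
  obtain ⟨m, rfl | rfl⟩ := n.even_or_odd'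
  · exact hN₁ m (by omega)
  · exact hN₂ m (by omega)

theorem derivative_eval_eq_zero_of_eq {P : ℂ[X]} (hP : 2 ≤ P.natDegree) {c b : ℂ}
    (hc : P = C P.leadingCoeff * (X - C c) ^ P.natDegree + C b) : P.derivative.eval c = 0 := by
  rw [hc]
  simp [derivative_pow, zero_pow (show P.natDegree - 1 ≠ 0 by omega)]

theorem eval_sub_of_eq {P : ℂ[X]} {c : ℂ}
    (hc : P = C P.leadingCoeff * (X - C c) ^ P.natDegree + C c) (w : ℂ) :
    P.eval w - c = P.leadingCoeff * (w - c) ^ P.natDegree := by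
  nth_rw 1 [hc]
  simp

/-- The point `c` is a superattracting fixed point: `‖a‖ ‖w - c‖ ^ d ≤ ‖w - c‖` once `‖w - c‖` is at
most `1` and `‖a‖⁻¹`. Complements of small discs about `c` are therefore backward invariant. -/
theorem exists_pos_forall_norm_eval_sub_lt {P : ℂ[X]} (hP : 2 ≤ P.natDegree) {c : ℂ}
    (hc : P = C P.leadingCoeff * (X - C c) ^ P.natDegree + C c) :
    ∃ ρ₀ > 0, ∀ ρ, 0 < ρ → ρ ≤ ρ₀ → ∀ w, ‖w - c‖ < ρ → ‖P.eval w - c‖ < ρ := by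
  have hP0 : P.leadingCoeff ≠ 0 := by
    rw [Ne, leadingCoeff_eq_zero]; rintro rfl; simp at hP
  have ha : 0 < ‖P.leadingCoeff‖ := norm_pos_iff.2 hP0
  refine ⟨min 1 ‖P.leadingCoeff‖⁻¹, by positivity, fun ρ hρ hρ₀ w hw => ?_⟩
  have h1 : ρ ≤ 1 := hρ₀.trans (min_le_left _ _)
  have h2 : ‖P.leadingCoeff‖ * ρ ≤ 1 := by
    rw [← le_inv_mul_iff₀ ha, mul_one]
    exact hρ₀.trans (min_le_right _ _)
  rw [eval_sub_of_eq hc, norm_mul, norm_pow]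
  calc ‖P.leadingCoeff‖ * ‖w - c‖ ^ P.natDegree ≤ ‖P.leadingCoeff‖ * ‖w - c‖ ^ 2 := by
        refine mul_le_mul_of_nonneg_left (pow_le_pow_of_le_one (norm_nonneg _) ?_ hP) ha.le
        linarith
    _ ≤ ‖P.leadingCoeff‖ * (ρ * ‖w - c‖) := by
        rw [sq]; gcongr
    _ ≤ ‖w - c‖ := by
        rw [← mul_assoc]
        exact mul_le_of_le_one_left (norm_nonneg _) h2
    _ < ρ := hw

/-- Over points at distance at least `ρ` from `c` the whole fibre stays at that distance, while by
Gauss–Lucas a disc of radius `ρ / 2` containing it would have centre within `ρ / 2` of `c`. The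
constant depends on `ρ`, so the limits for different `ρ` are compared afterwards. -/
theorem exists_forall_tendsto_rootAvg_of_eq {P : ℂ[X]} (hP : 2 ≤ P.natDegree) {c : ℂ}
    (hc : P = C P.leadingCoeff * (X - C c) ^ P.natDegree + C c) {f : ℂ → ℝ} (hf : Continuous f)
    (hfc : HasCompactSupport f) :
    ∃ L, ∀ y, y ≠ c → Tendsto (fun n => rootAvg (iter P n) f y) atTop (𝓝 L) := by
  obtain ⟨ρ₀, hρ₀, hmaps⟩ := exists_pos_forall_norm_eval_sub_lt hP hc
  have hder := derivative_ne_zero_of_natDegree_pos (show 0 < P.natDegree by omega)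
  have hdc := derivative_eval_eq_zero_of_eq hP hc
  have key : ∀ ρ, 0 < ρ → ρ ≤ ρ₀ → ∃ L, ∀ y ∈ {y : ℂ | ρ ≤ ‖y - c‖},
      Tendsto (fun n => rootAvg (iter P n) f y) atTop (𝓝 L) := by
    intro ρ hρ hρρ₀
    have hback : ∀ v, P.eval v ∈ {y : ℂ | ρ ≤ ‖y - c‖} → v ∈ {y : ℂ | ρ ≤ ‖y - c‖} := by
      intro v hv
      by_contra hlt
      exact (hmaps ρ hρ hρρ₀ v (not_le.1 hlt)).not_ge hv
    obtain ⟨K, hK, hle⟩ := exists_one_le_forall_root_pow_le (Q := P)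
      (Y := {y : ℂ | ρ ≤ ‖y - c‖}) (δ := ρ / 2) (by omega) (half_pos hρ) (by
        intro y hy w
        by_contra! hlt
        have b₁ := norm_sub_lt_of_forall_root (by omega) hder hdc hlt
        obtain ⟨v, hv⟩ := IsAlgClosed.exists_root (P - C y) (by
          rw [degree_sub_C (natDegree_pos_iff_degree_pos.1 (by omega))]
          exact (natDegree_pos_iff_degree_pos.1 (by omega)).ne')
        have hv : P.eval v = y := by simpa [sub_eq_zero] using hv
        have b₂ := hlt v hv
        have b₃ : ρ ≤ ‖v - c‖ := hback v (hv ▸ hy)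
        have := norm_sub_le (w - c) (w - v)
        rw [sub_sub_sub_cancel_left] at this
        linarith)
    exact exists_forall_tendsto_rootAvg (by omega) (by omega) hK hback hle hf hfc
  obtain ⟨L, hL⟩ := key ρ₀ hρ₀ le_rfl
  refine ⟨L, fun y hy => ?_⟩
  have hyc : 0 < ‖y - c‖ := norm_pos_iff.2 (sub_ne_zero.2 hy)
  obtain ⟨L', hL'⟩ := key (min ρ₀ ‖y - c‖) (lt_min hρ₀ hyc) (min_le_left _ _)
  -- The point `c + ρ₀` belongs to both sets, so the two limits agree there.
  have h0 : ‖c + ρ₀ - c‖ = ρ₀ := by simp [abs_of_pos hρ₀]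
  have : L' = L := tendsto_nhds_unique
    (hL' (c + ρ₀) (by simp only [Set.mem_ofPred_eq, h0]; exact min_le_left _ _))
    (hL (c + ρ₀) h0.ge)
  exact this ▸ hL' y (Set.mem_ofPred_eq ▸ min_le_right _ _)

/-- The condition on `y` says that `y` is not exceptional, by `coe_mem_exceptionalSet_iff`. -/
theorem exists_forall_tendsto_rootAvg_iter {P : ℂ[X]} (hP : 2 ≤ P.natDegree) {f : ℂ → ℝ}
    (hf : Continuous f) (hfc : HasCompactSupport f) :
    ∃ L, ∀ y, P ≠ C P.leadingCoeff * (X - C y) ^ P.natDegree + C y →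
      Tendsto (fun n => rootAvg (iter P n) f y) atTop (𝓝 L) := by
  rcases exists_eq_or_exists_derivative_comp_self_eq_zero hP with ⟨c, hc⟩ | ⟨c₁, c₂, hne, h₁, h₂⟩
  · obtain ⟨L, hL⟩ := exists_forall_tendsto_rootAvg_of_eq hP hc hf hfc
    exact ⟨L, fun y hy => hL y (by rintro rfl; exact hy hc)⟩
  · obtain ⟨L, hL⟩ := exists_forall_tendsto_rootAvg_of_derivative hP hne h₁ h₂ hf hfc
    exact ⟨L, fun y _ => hL y⟩

/-! ### Fibre measures on the sphere -/

theorem metrizableSpace_riemannSphere : TopologicalSpace.MetrizableSpace RiemannSphere :=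
  (onePointEquivSphereOfFinrankEq (ι := Fin 3) (V := ℂ)
    (by simp [Complex.finrank_real_complex])).isEmbedding.metrizableSpace

/-- Needed for uniqueness of weak limits and for the portmanteau inequality on open sets. -/
instance instHasOuterApproxClosedRiemannSphere : HasOuterApproxClosed RiemannSphere :=
  haveI := metrizableSpace_riemannSphere
  inferInstance

theorem lintegral_fiberMeasure_coe {P : ℂ[X]} (hP : 0 < P.natDegree) (y : ℂ)
    (φ : RiemannSphere → ℝ≥0∞) :
    ∫⁻ w, φ w ∂fiberMeasure P (y : RiemannSphere) = ((P - C y).roots.map fun w : ℂ => φ w).sum := by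
  have hne := sub_C_ne_zero hP y
  have hfib : sphereMap P ⁻¹' {(y : RiemannSphere)} =
      ((P - C y).roots.toFinset.map ⟨((↑) : ℂ → RiemannSphere), OnePoint.coe_injective⟩ :
        Finset RiemannSphere) := by
    ext w
    induction w using OnePoint.rec with
    | infty => simp
    | coe w => simp [hne, sub_eq_zero]
  rw [fiberMeasure, lintegral_sum_measure]
  simp only [lintegral_smul_measure, lintegral_dirac, smul_eq_mul]
  rw [hfib, Finset.tsum_subtype' _ (fun w : RiemannSphere => (localDegree P w : ℝ≥0∞) * φ w),
    Finset.sum_map, Finset.sum_multiset_map_count]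
  refine Finset.sum_congr rfl fun w hw => ?_
  have hw' : P.eval w = y := (mem_roots_sub_C_iff hP).1 (Multiset.mem_toFinset.1 hw)
  simp [localDegree_coe, hw']

theorem lintegral_fiberMeasure_infty (P : ℂ[X]) (φ : RiemannSphere → ℝ≥0∞) :
    ∫⁻ w, φ w ∂fiberMeasure P OnePoint.infty = P.natDegree * φ OnePoint.infty := by
  rw [fiberMeasure, lintegral_sum_measure]
  simp only [lintegral_smul_measure, lintegral_dirac, smul_eq_mul]
  rw [tsum_eq_single ⟨OnePoint.infty, rfl⟩]
  · simp [localDegree_infty]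
  · rintro ⟨v, hv⟩ hne
    exact absurd (Subtype.ext (sphereMap_eq_infty.1 hv)) hne

/-- The transfer operator of a polynomial, averaging a function over the fibres. -/
noncomputable def transfer (P : ℂ[X]) (φ : RiemannSphere → ℝ≥0∞) (z : RiemannSphere) : ℝ≥0∞ :=
  (P.natDegree : ℝ≥0∞)⁻¹ * ∫⁻ w, φ w ∂fiberMeasure P z

theorem measurable_transfer {P : ℂ[X]} (hP : 0 < P.natDegree) {φ : RiemannSphere → ℝ≥0∞}
    (hφ : Measurable φ) : Measurable (transfer P φ) :=
  ((Measure.measurable_lintegral hφ).comp (measurable_fiberMeasure hP)).const_mul _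

theorem natCast_inv_mul_cancel {n : ℕ} (hn : 0 < n) (x : ℝ≥0∞) : (n : ℝ≥0∞)⁻¹ * (n * x) = x := by
  rw [← mul_assoc, ENNReal.inv_mul_cancel (by exact_mod_cast hn.ne') (ENNReal.natCast_ne_top n),
    one_mul]

theorem transfer_infty {P : ℂ[X]} (hP : 0 < P.natDegree) (φ : RiemannSphere → ℝ≥0∞) :
    transfer P φ OnePoint.infty = φ OnePoint.infty := by
  rw [transfer, lintegral_fiberMeasure_infty, natCast_inv_mul_cancel hP]

theorem transfer_coe {P : ℂ[X]} (hP : 0 < P.natDegree) (φ : RiemannSphere → NNReal) (y : ℂ) :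
    transfer P (fun z => φ z) y = ENNReal.ofReal (rootAvg P (fun w => φ w) y) := by
  have hsum : ∀ s : Multiset ℂ, (s.map fun w : ℂ => (φ w : ℝ≥0∞)).sum =
      ENNReal.ofReal (s.map fun w : ℂ => (φ w : ℝ)).sum ∧
      0 ≤ (s.map fun w : ℂ => (φ w : ℝ)).sum := by
    intro s
    induction s using Multiset.induction with
    | empty => simp
    | cons w s ih =>
      simp only [Multiset.map_cons, Multiset.sum_cons]
      rw [ih.1, ENNReal.ofReal_add (φ w).coe_nonneg ih.2, ENNReal.ofReal_coe_nnreal]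
      exact ⟨rfl, add_nonneg (φ w).coe_nonneg ih.2⟩
  rw [transfer, lintegral_fiberMeasure_coe hP, (hsum _).1, rootAvg,
    ENNReal.ofReal_mul (by positivity), ENNReal.ofReal_inv_of_pos (by exact_mod_cast hP),
    ENNReal.ofReal_natCast]

theorem transfer_le {P : ℂ[X]} (hP : 0 < P.natDegree) {φ : RiemannSphere → ℝ≥0∞} {M : ℝ≥0∞}
    (hφ : ∀ z, φ z ≤ M) (z : RiemannSphere) : transfer P φ z ≤ M := by
  calc transfer P φ z ≤ (P.natDegree : ℝ≥0∞)⁻¹ * ∫⁻ _, M ∂fiberMeasure P z :=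
        mul_le_mul' le_rfl (lintegral_mono hφ)
    _ = M := by rw [lintegral_const, fiberMeasure_univ hP, mul_comm M, natCast_inv_mul_cancel hP]

theorem transfer_comp {A B : ℂ[X]} (hA : 0 < A.natDegree) (hB : 0 < B.natDegree)
    (φ : RiemannSphere → ℝ≥0∞) (z : RiemannSphere) :
    transfer (A.comp B) φ z = transfer A (transfer B φ) z := by
  have hAB : 0 < (A.comp B).natDegree := by rw [natDegree_comp]; positivity
  induction z using OnePoint.rec with
  | infty => rw [transfer_infty hAB, transfer_infty hA, transfer_infty hB]
  | coe y =>
    have : ((A - C y).roots.map fun v : ℂ => transfer B φ v).sum = (B.natDegree : ℝ≥0∞)⁻¹ *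
        ((A - C y).roots.map fun v => ((B - C v).roots.map fun w : ℂ => φ w).sum).sum := by
      rw [← Multiset.sum_map_mul_left]
      refine congrArg _ (Multiset.map_congr rfl fun v _ => ?_)
      rw [transfer, lintegral_fiberMeasure_coe hB]
    rw [transfer, lintegral_fiberMeasure_coe hAB, roots_comp_sub_C hA hB, Multiset.map_bind,
      Multiset.sum_bind, natDegree_comp, transfer, lintegral_fiberMeasure_coe hA, this,
      Nat.cast_mul, ENNReal.mul_inv (Or.inr (ENNReal.natCast_ne_top _))
        (Or.inl (ENNReal.natCast_ne_top _)), mul_assoc]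

/-- Duality turns weak convergence of pullbacks into pointwise convergence of fibre averages. -/
theorem lintegral_normalizedPullback {P : ℂ[X]} (hP : 0 < P.natDegree) (n : ℕ)
    (ν : ProbabilityMeasure RiemannSphere) {φ : RiemannSphere → ℝ≥0∞} (hφ : Measurable φ) :
    ∫⁻ z, φ z ∂(normalizedPullback P hP n ν : Measure RiemannSphere) =
      ∫⁻ z, transfer (iter P n) φ z ∂(ν : Measure RiemannSphere) := by
  have hn := natDegree_iter_pos hP n
  rw [normalizedPullback, ProbabilityMeasure.coe_mk, lintegral_smul_measure, pullback,
    Measure.lintegral_bind (measurable_fiberMeasure hn).aemeasurable hφ.aemeasurable, smul_eq_mul]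
  simp only [transfer]
  have hm : Measurable fun z => ∫⁻ w, φ w ∂fiberMeasure (iter P n) z :=
    (Measure.measurable_lintegral hφ).comp (measurable_fiberMeasure hn)
  rw [lintegral_const_mul _ hm, natDegree_iter, Nat.cast_pow]

theorem normalizedPullback_one {P : ℂ[X]} (hP : 0 < P.natDegree)
    (ν : ProbabilityMeasure RiemannSphere) :
    (normalizedPullback P hP 1 ν : Measure RiemannSphere) =
      (P.natDegree : ℝ≥0∞)⁻¹ • pullback P (ν : Measure RiemannSphere) := by
  rw [normalizedPullback, ProbabilityMeasure.coe_mk, pow_one, iter_one]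

/-! ### Continuity of the transfer operator -/

/-- Infinity is attracting: if `log ‖w‖ > K`, then `log⁺ ‖P w‖ ≥ 2 log ‖w‖ - K > log ‖w‖`. -/
theorem exists_forall_lt_norm_eval {P : ℂ[X]} (hP : 2 ≤ P.natDegree) :
    ∃ R₀ : ℝ, ∀ R, R₀ ≤ R → ∀ w, R < ‖w‖ → R < ‖P.eval w‖ := by
  obtain ⟨K, hK⟩ := exists_abs_posLog_eval_sub_le (P := P) (by omega)
  refine ⟨max 1 (Real.exp K), fun R hR w hw => ?_⟩
  have h1 : 1 ≤ R := (le_max_left _ _).trans hR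
  have h2 : Real.exp K ≤ R := (le_max_right _ _).trans hR
  by_contra! hcon
  have h3 : K < Real.log ‖w‖ := (Real.lt_log_iff_exp_lt (by linarith)).2 (by linarith)
  have h4 : Real.posLog ‖w‖ = Real.log ‖w‖ :=
    Real.posLog_eq_log (by rw [abs_norm]; linarith)
  have h5 : Real.posLog ‖P.eval w‖ ≤ Real.posLog ‖w‖ :=
    Real.posLog_le_posLog (norm_nonneg _) (by linarith)
  have h6 := abs_le.1 (hK w)
  have h7 : (2 : ℝ) ≤ P.natDegree := by exact_mod_cast hP
  have h8 := mul_le_mul_of_nonneg_right h7 (Real.posLog_nonneg (x := ‖w‖))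
  rw [h4] at h5 h6 h8
  linarith

theorem exists_fin_map_eq_roots_sub_C (P : ℂ[X]) (y : ℂ) :
    ∃ v : Fin P.natDegree → ℂ, Finset.univ.val.map v = (P - C y).roots := by
  obtain ⟨l, hl⟩ := Quot.exists_rep (P - C y).roots
  have hlen : l.length = P.natDegree := by
    rw [← card_roots_sub_C P y, ← hl]; rfl
  refine ⟨fun i => l.get (i.cast hlen.symm), ?_⟩
  rw [Fin.univ_val_map, ← hl]
  refine congrArg _ (List.ext_getElem (by simp [hlen]) fun i h₁ h₂ => by simp)

/-- The roots depend continuously on `y` as an unordered tuple. Enumerations of nearby fibres stay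
in a compact ball, and any subsequential limit satisfies the factorization of `P - y`, hence
enumerates the fibre over `y`; the sum of `f` does not see the order. -/
theorem continuous_rootAvg {P : ℂ[X]} (hP : 2 ≤ P.natDegree) {f : ℂ → ℝ} (hf : Continuous f) :
    Continuous (rootAvg P f) := by
  have hP0 : P.leadingCoeff ≠ 0 := by
    rw [Ne, leadingCoeff_eq_zero]; rintro rfl; simp at hP
  choose v hv using exists_fin_map_eq_roots_sub_C P
  have hsum : ∀ y, rootAvg P f y = (P.natDegree : ℝ)⁻¹ * ∑ i, f (v y i) := fun y => by
    rw [rootAvg, ← hv, Multiset.map_map]; rfl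
  have hprod : ∀ y w, P.eval w - y = P.leadingCoeff * ∏ i, (w - v y i) := fun y w => by
    rw [eval_sub_eq_prod (by omega), ← hv, Multiset.map_map]; rfl
  obtain ⟨R₀, hR₀⟩ := exists_forall_lt_norm_eval hP
  rw [continuous_iff_continuousAt]
  intro y
  -- Large enough that points outside the disc map outside it, and that the disc contains a
  -- neighbourhood of `y`.
  set R := max (max R₀ 0) (‖y‖ + 1)
  have hbd : ∀ y' : ℂ, ‖y'‖ ≤ R → v y' ∈ Metric.closedBall (0 : Fin P.natDegree → ℂ) R := by
    intro y' hy'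
    rw [mem_closedBall_zero_iff, pi_norm_le_iff_of_nonneg
      ((le_max_right R₀ 0).trans (le_max_left _ _))]
    intro i
    by_contra! hlt
    have hroot : P.eval (v y' i) = y' := (mem_roots_sub_C_iff (by omega)).1 (by
      rw [← hv]; exact Multiset.mem_map_of_mem _ (Finset.mem_univ_val i))
    have := hR₀ R ((le_max_left R₀ 0).trans (le_max_left _ _)) _ hlt
    rw [hroot] at this
    linarith
  have hnear : ∀ᶠ y' in 𝓝 y, ‖y'‖ ≤ R := by
    filter_upwards [Metric.ball_mem_nhds y one_pos] with y' hy'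
    have := norm_sub_norm_le y' y
    rw [mem_ball_iff_norm] at hy'
    exact le_trans (by linarith) (le_max_right _ _)
  refine tendsto_of_subseq_tendsto fun ys hys => ?_
  obtain ⟨u, -, ms, hmono, hms⟩ := (isCompact_closedBall (0 : Fin P.natDegree → ℂ) R).tendsto_subseq'
    (x := fun n => v (ys n)) ((hys.eventually hnear).mono fun n hn => hbd _ hn).frequently
  have hys' : Tendsto (fun n => ys (ms n)) atTop (𝓝 y) := hys.comp hmono.tendsto_atTop
  have hcoord : ∀ i, Tendsto (fun n => v (ys (ms n)) i) atTop (𝓝 (u i)) :=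
    fun i => (tendsto_pi_nhds.1 hms) i
  have hu : ∀ w, P.eval w - y = P.leadingCoeff * ∏ i, (w - u i) := by
    intro w
    have h1 : Tendsto (fun n => P.eval w - ys (ms n)) atTop (𝓝 (P.eval w - y)) :=
      hys'.const_sub _
    have h2 : Tendsto (fun n => P.leadingCoeff * ∏ i, (w - v (ys (ms n)) i)) atTop
        (𝓝 (P.leadingCoeff * ∏ i, (w - u i))) :=
      (tendsto_finsetProd _ fun i _ => (hcoord i).const_sub w).const_mul _
    simp only [hprod] at h1
    rw [← hprod y w] at h1
    exact tendsto_nhds_unique h1 h2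
  have hroots : (P - C y).roots = Finset.univ.val.map u := by
    have : P - C y = C P.leadingCoeff * ((Finset.univ.val.map u).map fun a => X - C a).prod := by
      refine Polynomial.funext fun w => ?_
      rw [eval_sub, eval_C, hu, eval_mul, eval_C, eval_multiset_prod, Multiset.map_map,
        Multiset.map_map]
      simp [Finset.prod_eq_multiset_prod]
    rw [this, roots_C_mul _ hP0, roots_multiset_prod_X_sub_C]
  have hy : rootAvg P f y = (P.natDegree : ℝ)⁻¹ * ∑ i, f (u i) := by
    rw [rootAvg, hroots, Multiset.map_map]; rfl
  refine ⟨ms, ?_⟩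
  simp only [hsum]
  rw [← hsum y, hy]
  exact (tendsto_finsetSum _ fun i _ => (hf.tendsto _).comp (hcoord i)).const_mul _

/-- If `y` avoids the compact set `P(t)`, its whole fibre avoids `t`. -/
theorem tendsto_rootAvg_cocompact {P : ℂ[X]} (hP : 0 < P.natDegree) {f : ℂ → ℝ} {L : ℝ}
    (hf : Tendsto f (cocompact ℂ) (𝓝 L)) : Tendsto (rootAvg P f) (cocompact ℂ) (𝓝 L) := by
  rw [Metric.tendsto_nhds]
  intro ε hε
  obtain ⟨t, ht, hts⟩ := mem_cocompact.1 (Metric.tendsto_nhds.1 hf (ε / 2) (half_pos hε))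
  filter_upwards [(ht.image P.continuous).compl_mem_cocompact] with y hy
  have := abs_rootAvg_sub_le (f := f) (g := fun _ => L) (η := ε / 2) hP y fun v hv => by
    have : v ∈ tᶜ := fun hvt => hy ⟨v, hvt, hv⟩
    have := hts this
    rw [Set.mem_ofPred_eq, Real.dist_eq] at this
    exact this.le
  rw [rootAvg_const hP] at this
  rw [Real.dist_eq]
  linarith

theorem continuous_transfer {P : ℂ[X]} (hP : 2 ≤ P.natDegree) {φ : RiemannSphere → NNReal}
    (hφ : Continuous φ) : Continuous (transfer P fun z => φ z) := by
  have hP0 : 0 < P.natDegree := by omega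
  have hφ' := (OnePoint.continuous_iff φ).1 hφ
  rw [coclosedCompact_eq_cocompact] at hφ'
  rw [OnePoint.continuous_iff, coclosedCompact_eq_cocompact, transfer_infty hP0]
  simp only [transfer_coe hP0]
  refine ⟨?_, ENNReal.continuous_ofReal.comp
    (continuous_rootAvg hP (NNReal.continuous_coe.comp hφ'.2))⟩
  rw [← ENNReal.ofReal_coe_nnreal]
  exact ENNReal.tendsto_ofReal (tendsto_rootAvg_cocompact hP0
    ((NNReal.continuous_coe.tendsto _).comp hφ'.1))

/-! ### The exceptional set -/

theorem infty_mem_exceptionalSet (P : ℂ[X]) : OnePoint.infty ∈ exceptionalSet P := by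
  refine ⟨{OnePoint.infty}, ⟨Set.finite_singleton _, ?_, ?_⟩, rfl⟩
  · simp
  · ext w
    simp [sphereMap_eq_infty]

theorem eq_of_derivative_eval_eq_zero {P : ℂ[X]} (hP : 2 ≤ P.natDegree) {c b z : ℂ}
    (hc : P = C P.leadingCoeff * (X - C c) ^ P.natDegree + C b)
    (hd : P.derivative.eval z = 0) : z = c := by
  rw [hc] at hd
  have hP0 : P ≠ 0 := by rintro rfl; simp at hP
  have hn : P.natDegree ≠ 0 := by omega
  simp [derivative_pow, hP0, hn] at hd
  exact sub_eq_zero.1 hd.1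

/-- `P` is injective on the finite invariant set `E`, and `E` contains all preimages of its points.
Hence each finite point of `E` is the only preimage of its image, and `P` is totally ramified there.
-/
theorem coe_mem_exceptionalSet_iff {P : ℂ[X]} (hP : 2 ≤ P.natDegree) {z : ℂ} :
    (z : RiemannSphere) ∈ exceptionalSet P ↔
      P = C P.leadingCoeff * (X - C z) ^ P.natDegree + C z := by
  have hP0 : P.leadingCoeff ≠ 0 := by
    rw [Ne, leadingCoeff_eq_zero]; rintro rfl; simp at hP
  constructor
  · intro hz
    obtain ⟨hfin, himg, hpre⟩ := (isGreatest_exceptionalSet hP).1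
    have hmaps : Set.MapsTo (sphereMap P) (exceptionalSet P) (exceptionalSet P) := fun w hw =>
      himg ▸ Set.mem_image_of_mem _ hw
    have hinj : Set.InjOn (sphereMap P) (exceptionalSet P) :=
      ((hfin.surjOn_iff_bijOn_of_mapsTo hmaps).1 himg.ge).injOn
    have hform : ∀ w : ℂ, (w : RiemannSphere) ∈ exceptionalSet P →
        P = C P.leadingCoeff * (X - C w) ^ P.natDegree + C (P.eval w) := by
      intro w hw
      have hrep : (P - C (P.eval w)).roots = Multiset.replicate P.natDegree w := by
        refine Multiset.eq_replicate.2 ⟨card_roots_sub_C _ _, fun v hv => ?_⟩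
        have hv' : P.eval v = P.eval w := (mem_roots_sub_C_iff (by omega)).1 hv
        have hvw : sphereMap P v = sphereMap P w := by rw [sphereMap_coe, sphereMap_coe, hv']
        have hvE : (v : RiemannSphere) ∈ exceptionalSet P := by
          rw [← hpre, Set.mem_preimage, hvw]; exact hmaps hw
        exact OnePoint.coe_injective (hinj hvE hw hvw)
      have := sub_C_eq_prod (Q := P) (by omega) (P.eval w)
      rw [hrep, Multiset.map_replicate, Multiset.prod_replicate] at this
      exact sub_eq_iff_eq_add.1 this
    have h1 := hform z hz
    -- Both `z` and `P z` are totally ramified, but such a polynomial has only one critical point;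
    -- hence `P z = z`.
    have h2 := hform (P.eval z) (hmaps hz)
    have h3 := derivative_eval_eq_zero_of_eq hP h2
    have h4 := eq_of_derivative_eval_eq_zero hP h1 h3
    rwa [h4] at h1
  · intro hz
    have heval := eval_sub_of_eq hz
    have hzz : P.eval z = z := by
      have := heval z
      rwa [sub_self, zero_pow (by omega), mul_zero, sub_eq_zero] at this
    refine ⟨{(z : RiemannSphere)}, ⟨Set.finite_singleton _, ?_, ?_⟩, rfl⟩
    · simp [hzz]
    · ext w
      induction w using OnePoint.rec with
      | infty => simp
      | coe w =>
        simp only [Set.mem_preimage, sphereMap_coe, Set.mem_singleton_iff, OnePoint.coe_eq_coe]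
        refine ⟨fun hw => ?_, fun hw => hw ▸ hzz⟩
        have := heval w
        rw [hw, sub_self, eq_comm, mul_eq_zero] at this
        exact sub_eq_zero.1 (pow_eq_zero_iff (by omega) |>.1 (this.resolve_left hP0))

/-! ### Weak convergence of the iterated pullbacks -/

/-- Cutting off `f - L` outside a large disc reduces continuous functions on the sphere to compactly
supported ones plus a constant. -/
theorem exists_hasCompactSupport_forall_abs_sub_le {f : ℂ → ℝ} (hf : Continuous f) {L : ℝ}
    (hL : Tendsto f (cocompact ℂ) (𝓝 L)) {η : ℝ} (hη : 0 < η) :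
    ∃ g : ℂ → ℝ, Continuous g ∧ HasCompactSupport g ∧ ∀ w, |f w - (g w + L)| ≤ η := by
  obtain ⟨t, ht, hts⟩ := mem_cocompact.1 (Metric.tendsto_nhds.1 hL η hη)
  obtain ⟨R, hR⟩ := ht.isBounded.exists_norm_le
  set χ : ℂ → ℝ := fun w => max 0 (min 1 (R + 1 - ‖w‖))
  have hχ0 : ∀ w, 0 ≤ χ w := fun w => le_max_left _ _
  have hχ1 : ∀ w, χ w ≤ 1 := fun w => max_le zero_le_one (min_le_left _ _)
  refine ⟨fun w => (f w - L) * χ w, by fun_prop,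
    HasCompactSupport.intro (isCompact_closedBall (0 : ℂ) (R + 1)) fun w hw => ?_, fun w => ?_⟩
  · have : R + 1 < ‖w‖ := not_le.1 (mt mem_closedBall_zero_iff.2 hw)
    have : χ w = 0 := max_eq_left ((min_le_right _ _).trans (by linarith))
    rw [this, mul_zero]
  · have h1 : f w - ((f w - L) * χ w + L) = (f w - L) * (1 - χ w) := by ring
    rw [h1, abs_mul, abs_of_nonneg (sub_nonneg.2 (hχ1 w))]
    by_cases hw : w ∈ t
    · have : χ w = 1 := by
        have := hR w hw
        simp only [χ]
        rw [min_eq_left (by linarith), max_eq_right zero_le_one]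
      rw [this, sub_self, mul_zero]; exact hη.le
    · have h2 : |f w - L| < η := hts hw
      calc |f w - L| * (1 - χ w) ≤ |f w - L| * 1 := by
            gcongr; linarith [hχ0 w]
        _ ≤ η := by rw [mul_one]; exact h2.le

theorem rootAvg_add_const {Q : ℂ[X]} (hQ : 0 < Q.natDegree) (f : ℂ → ℝ) (L : ℝ) (y : ℂ) :
    rootAvg Q (fun w => f w + L) y = rootAvg Q f y + L := by
  nth_rw 2 [← rootAvg_const hQ L y]
  rw [rootAvg, Multiset.sum_map_add, mul_add]; rfl

theorem exists_forall_tendsto_transfer_iter {P : ℂ[X]} (hP : 2 ≤ P.natDegree)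
    {φ : RiemannSphere → NNReal} (hφ : Continuous φ) :
    ∃ L, ∀ x ∉ exceptionalSet P,
      Tendsto (fun n => transfer (iter P n) (fun z => φ z) x) atTop (𝓝 L) := by
  have hP0 : 0 < P.natDegree := by omega
  have hφ' := (OnePoint.continuous_iff φ).1 hφ
  rw [coclosedCompact_eq_cocompact] at hφ'
  obtain ⟨L, hL⟩ := exists_forall_tendsto_of_forall_eventually
    (ι := {y : ℂ // (y : RiemannSphere) ∉ exceptionalSet P})
    (x := fun y n => rootAvg (iter P n) (fun w => φ w) y) (by
      intro η hη
      obtain ⟨g, hg, hgc, hgφ⟩ := exists_hasCompactSupport_forall_abs_sub_le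
        (NNReal.continuous_coe.comp hφ'.2) ((NNReal.continuous_coe.tendsto _).comp hφ'.1)
        (half_pos hη)
      obtain ⟨m, hm⟩ := exists_forall_tendsto_rootAvg_iter hP hg hgc
      -- Fibre averages reproduce the constant `φ ∞`, so it is added to the limit for the compactly
      -- supported part.
      refine ⟨m + φ OnePoint.infty, fun ⟨y, hy⟩ => ?_⟩
      rw [coe_mem_exceptionalSet_iff hP] at hy
      filter_upwards [Metric.tendsto_nhds.1 (hm y hy) (η / 2) (half_pos hη)] with n hn
      have h1 := abs_rootAvg_sub_le (natDegree_iter_pos hP0 n) y fun v _ => hgφ v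
      rw [rootAvg_add_const (natDegree_iter_pos hP0 n)] at h1
      rw [Real.dist_eq, abs_lt] at hn
      rw [abs_le] at h1 ⊢
      simp only [Function.comp_def] at h1
      constructor <;> linarith)
  refine ⟨ENNReal.ofReal L, fun x hx => ?_⟩
  induction x using OnePoint.rec with
  | infty => exact absurd (infty_mem_exceptionalSet P) hx
  | coe y =>
    simp only [transfer_coe (natDegree_iter_pos hP0 _)]
    exact ENNReal.tendsto_ofReal (hL ⟨y, hx⟩)

/-! ### The limit measure and its invariance -/

/-- The point mass at a point of the sphere, as a probability measure. -/
noncomputable abbrev diracProb (x : RiemannSphere) : ProbabilityMeasure RiemannSphere :=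
  ⟨Measure.dirac x, Measure.dirac.isProbabilityMeasure⟩

theorem lintegral_normalizedPullback_dirac {P : ℂ[X]} (hP : 0 < P.natDegree) (n : ℕ)
    (x : RiemannSphere) {φ : RiemannSphere → ℝ≥0∞} (hφ : Measurable φ) :
    ∫⁻ z, φ z ∂(normalizedPullback P hP n (diracProb x) : Measure RiemannSphere) =
      transfer (iter P n) φ x := by
  rw [lintegral_normalizedPullback hP n _ hφ]
  exact lintegral_dirac _ _

theorem measurable_coe_comp {φ : RiemannSphere → NNReal} (hφ : Continuous φ) :
    Measurable fun z => (φ z : ℝ≥0∞) :=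
  (ENNReal.continuous_coe.comp hφ).measurable

/-- Compactness gives a cluster point for the base point `y`. Integrals of test functions already
converge, to limits independent of the base point, so this cluster point is the limit for every `x`.
-/
theorem exists_forall_tendsto_normalizedPullback_dirac {P : ℂ[X]} (hP : 2 ≤ P.natDegree)
    (hP0 : 0 < P.natDegree) {y : RiemannSphere} (hy : y ∉ exceptionalSet P) :
    ∃ μ : ProbabilityMeasure RiemannSphere, ∀ x ∉ exceptionalSet P,
      Tendsto (fun n => normalizedPullback P hP0 n (diracProb x)) atTop (𝓝 μ) := by
  obtain ⟨μ, -, hμ⟩ := isCompact_univ.exists_mapClusterPt (f := atTop)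
    (u := fun n => normalizedPullback P hP0 n (diracProb y)) (by simp)
  obtain ⟨U, hU, hUμ⟩ := mapClusterPt_iff_ultrafilter.1 hμ
  refine ⟨μ, fun x hx => ProbabilityMeasure.tendsto_iff_forall_lintegral_tendsto.2 fun φ => ?_⟩
  have hm := measurable_coe_comp φ.continuous
  obtain ⟨L, hL⟩ := exists_forall_tendsto_transfer_iter hP φ.continuous
  have h1 := ProbabilityMeasure.tendsto_iff_forall_lintegral_tendsto.1 hUμ φ
  simp only [lintegral_normalizedPullback_dirac hP0 _ _ hm] at h1 ⊢
  rw [tendsto_nhds_unique h1 ((hL y hy).mono_left hU)]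
  exact hL x hx

/-- A point of a forward invariant set cannot be an iterated preimage of a point outside it. -/
theorem normalizedPullback_dirac_eq_zero {P : ℂ[X]} (hP0 : 0 < P.natDegree) {U : Set RiemannSphere}
    (hU : MeasurableSet U) (hmaps : Set.MapsTo (sphereMap P) U U) {x : RiemannSphere} (hx : x ∉ U)
    (n : ℕ) : (normalizedPullback P hP0 n (diracProb x) : Measure RiemannSphere) U = 0 := by
  rw [← lintegral_indicator_one hU,
    lintegral_normalizedPullback_dirac hP0 n x (measurable_one.indicator hU), transfer,
    lintegral_indicator_one hU, fiberMeasure_apply _ _ hU]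
  refine mul_eq_zero_of_right _ (ENNReal.tsum_eq_zero.2 ?_)
  rintro ⟨w, hw⟩
  have : w ∉ U := fun hwU => hx (by
    have := hmaps.iterate n hwU
    rwa [← sphereMap_iter, show sphereMap (iter P n) w = x from hw] at this)
  simp [this]

theorem measure_eq_zero_of_tendsto {P : ℂ[X]} (hP0 : 0 < P.natDegree) {U : Set RiemannSphere}
    (hU : IsOpen U) (hmaps : Set.MapsTo (sphereMap P) U U) {x : RiemannSphere} (hx : x ∉ U)
    {μ : ProbabilityMeasure RiemannSphere}
    (hμ : Tendsto (fun n => normalizedPullback P hP0 n (diracProb x)) atTop (𝓝 μ)) :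
    (μ : Measure RiemannSphere) U = 0 := by
  have := ProbabilityMeasure.le_liminf_measure_open_of_tendsto hμ hU
  simpa [normalizedPullback_dirac_eq_zero hP0 hU.measurableSet hmaps hx] using this

theorem exists_coe_notMem_exceptionalSet {P : ℂ[X]} (hP : 2 ≤ P.natDegree) :
    ∃ y : ℂ, (y : RiemannSphere) ∉ exceptionalSet P := by
  by_contra! h
  have h0 := (coe_mem_exceptionalSet_iff hP).1 (h 0)
  have h1 := (coe_mem_exceptionalSet_iff hP).1 (h 1)
  exact one_ne_zero (eq_of_derivative_eval_eq_zero hP h0 (derivative_eval_eq_zero_of_eq hP h1))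

/-- Exceptional points attract, so each has a forward invariant open neighbourhood avoiding `y`: the
outside of a large disc for infinity, a small disc for a finite point. The limit measure gives it no
mass. -/
theorem measure_exceptionalSet_eq_zero {P : ℂ[X]} (hP : 2 ≤ P.natDegree) (hP0 : 0 < P.natDegree)
    {y : ℂ} (hy : (y : RiemannSphere) ∉ exceptionalSet P) {μ : ProbabilityMeasure RiemannSphere}
    (hμ : Tendsto (fun n => normalizedPullback P hP0 n (diracProb y)) atTop (𝓝 μ)) :
    (μ : Measure RiemannSphere) (exceptionalSet P) = 0 := by
  rw [measure_null_iff_singleton (isGreatest_exceptionalSet hP).1.1.countable]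
  intro z hz
  suffices ∃ U : Set RiemannSphere, IsOpen U ∧ Set.MapsTo (sphereMap P) U U ∧
      (y : RiemannSphere) ∉ U ∧ z ∈ U by
    obtain ⟨U, hU, hmaps, hyU, hzU⟩ := this
    exact measure_mono_null (Set.singleton_subset_iff.2 hzU)
      (measure_eq_zero_of_tendsto hP0 hU hmaps hyU hμ)
  induction z using OnePoint.rec with
  | infty =>
    obtain ⟨R₀, hR₀⟩ := exists_forall_lt_norm_eval hP
    refine ⟨((↑) '' Metric.closedBall (0 : ℂ) (max R₀ ‖y‖))ᶜ, ?_, ?_, ?_, by simp⟩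
    · exact ((isCompact_closedBall _ _).image OnePoint.continuous_coe).isClosed.isOpen_compl
    · rintro w hw ⟨v, hv, hvw⟩
      induction w using OnePoint.rec with
      | infty => simp at hvw
      | coe w =>
        rw [sphereMap_coe, OnePoint.coe_eq_coe] at hvw
        have hw' : max R₀ ‖y‖ < ‖w‖ := by
          by_contra! hle
          exact hw ⟨w, mem_closedBall_zero_iff.2 hle, rfl⟩
        have := hR₀ _ (le_max_left _ _) w hw'
        rw [← hvw] at this
        exact this.not_ge (mem_closedBall_zero_iff.1 hv)
    · exact fun h => h ⟨y, mem_closedBall_zero_iff.2 (le_max_right _ _), rfl⟩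
  | coe c =>
    have hc := (coe_mem_exceptionalSet_iff hP).1 hz
    obtain ⟨ρ₀, hρ₀, hmaps⟩ := exists_pos_forall_norm_eval_sub_lt hP hc
    have hyc : 0 < ‖y - c‖ := norm_pos_iff.2 (sub_ne_zero.2 (by rintro rfl; exact hy hz))
    refine ⟨(↑) '' Metric.ball c (min ρ₀ ‖y - c‖), ?_, ?_, ?_, ?_⟩
    · exact OnePoint.isOpenEmbedding_coe.isOpenMap _ Metric.isOpen_ball
    · rintro _ ⟨w, hw, rfl⟩
      exact ⟨P.eval w, mem_ball_iff_norm.2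
        (hmaps _ (lt_min hρ₀ hyc) (min_le_left _ _) w (mem_ball_iff_norm.1 hw)), rfl⟩
    · rintro ⟨w, hw, hwy⟩
      rw [OnePoint.coe_eq_coe.1 hwy, mem_ball_iff_norm] at hw
      exact hw.not_ge (min_le_right _ _)
    · exact ⟨c, Metric.mem_ball_self (lt_min hρ₀ hyc), rfl⟩

/-- Fibre averages are bounded by the supremum of the test function and converge at `ν`-almost every
point; dominated convergence applies. -/
theorem tendsto_normalizedPullback {P : ℂ[X]} (hP0 : 0 < P.natDegree)
    {μ : ProbabilityMeasure RiemannSphere}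
    (hμ : ∀ x ∉ exceptionalSet P,
      Tendsto (fun n => normalizedPullback P hP0 n (diracProb x)) atTop (𝓝 μ))
    (ν : ProbabilityMeasure RiemannSphere)
    (hν : (ν : Measure RiemannSphere) (exceptionalSet P) = 0) :
    Tendsto (fun n => normalizedPullback P hP0 n ν) atTop (𝓝 μ) := by
  refine ProbabilityMeasure.tendsto_iff_forall_lintegral_tendsto.2 fun φ => ?_
  have hm := measurable_coe_comp φ.continuous
  simp only [lintegral_normalizedPullback hP0 _ ν hm]
  have hconst : ∫⁻ z, φ z ∂(μ : Measure RiemannSphere) =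
      ∫⁻ _, (∫⁻ z, φ z ∂(μ : Measure RiemannSphere)) ∂(ν : Measure RiemannSphere) := by
    rw [lintegral_const, measure_univ, mul_one]
  rw [hconst]
  refine tendsto_lintegral_of_dominated_convergence (fun _ => (nndist φ 0 : ℝ≥0∞))
    (fun n => measurable_transfer (natDegree_iter_pos hP0 n) hm)
    (fun n => ae_of_all _ fun z => transfer_le (natDegree_iter_pos hP0 n) (fun w => ?_) z) ?_ ?_
  · exact ENNReal.coe_le_coe.2 (BoundedContinuousFunction.NNReal.upper_bound φ w)
  · rw [lintegral_const, measure_univ, mul_one]; exact ENNReal.coe_ne_top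
  · filter_upwards [measure_eq_zero_iff_ae_notMem.1 hν] with x hx
    have := ProbabilityMeasure.tendsto_iff_forall_lintegral_tendsto.1 (hμ x hx) φ
    simpa only [lintegral_normalizedPullback_dirac hP0 _ _ hm] using this

/-- The fibre average of a continuous test function is again a test function, so one pullback is
weakly continuous. Applied to the sequence, it only shifts the index. -/
theorem normalizedPullback_one_eq_of_tendsto {P : ℂ[X]} (hP : 2 ≤ P.natDegree)
    (hP0 : 0 < P.natDegree) {x : RiemannSphere} {μ : ProbabilityMeasure RiemannSphere}
    (hμ : Tendsto (fun n => normalizedPullback P hP0 n (diracProb x)) atTop (𝓝 μ)) :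
    normalizedPullback P hP0 1 μ = μ := by
  refine tendsto_nhds_unique ?_ (hμ.comp (tendsto_add_atTop_nat 1))
  refine ProbabilityMeasure.tendsto_iff_forall_lintegral_tendsto.2 fun φ => ?_
  have hm := measurable_coe_comp φ.continuous
  have hfin : ∀ z, transfer P (fun z => φ z) z ≠ ⊤ := fun z =>
    ((transfer_le hP0 (M := (nndist φ 0 : ℝ≥0∞)) (fun w =>
      ENNReal.coe_le_coe.2 (BoundedContinuousFunction.NNReal.upper_bound φ w)) z).trans_lt
      ENNReal.coe_lt_top).ne
  let ψ : BoundedContinuousFunction RiemannSphere NNReal :=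
    BoundedContinuousFunction.mkOfCompact ⟨fun z => (transfer P (fun z => φ z) z).toNNReal,
      ENNReal.continuousOn_toNNReal.comp_continuous (continuous_transfer hP φ.continuous) hfin⟩
  have hψ : ∀ z, (ψ z : ℝ≥0∞) = transfer P (fun z => φ z) z := fun z =>
    ENNReal.coe_toNNReal (hfin z)
  have h1 := ProbabilityMeasure.tendsto_iff_forall_lintegral_tendsto.1 hμ ψ
  simp only [hψ, lintegral_normalizedPullback_dirac hP0 _ _ (measurable_transfer hP0 hm)] at h1
  simp only [Function.comp_def, lintegral_normalizedPullback_dirac hP0 _ _ hm,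
    lintegral_normalizedPullback hP0 1 μ hm, iter_one]
  refine h1.congr fun n => ?_
  rw [iter_add, iter_one, transfer_comp (natDegree_iter_pos hP0 n) hP0]

theorem normalizedPullback_eq_of_one_eq {P : ℂ[X]} (hP0 : 0 < P.natDegree)
    {ν : ProbabilityMeasure RiemannSphere} (hν : normalizedPullback P hP0 1 ν = ν) (n : ℕ)
    {φ : RiemannSphere → ℝ≥0∞} (hφ : Measurable φ) :
    ∫⁻ z, φ z ∂(normalizedPullback P hP0 n ν : Measure RiemannSphere) =
      ∫⁻ z, φ z ∂(ν : Measure RiemannSphere) := by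
  rw [lintegral_normalizedPullback hP0 n ν hφ]
  induction n with
  | zero =>
    have h := natDegree_iter_pos hP0 0
    refine lintegral_congr fun z => ?_
    induction z using OnePoint.rec with
    | infty => rw [transfer_infty h]
    | coe y =>
      rw [transfer, lintegral_fiberMeasure_coe h]
      simp [iter]
  | succ n ih =>
    have hn := natDegree_iter_pos hP0 n
    rw [← ih]
    nth_rw 2 [← hν]
    rw [lintegral_normalizedPullback hP0 1 ν (measurable_transfer hn hφ), iter_one]
    simp only [iter_succ, transfer_comp hP0 hn]

end PolyDyn

theorem mainTheorem1 (P : Polynomial ℂ) (hP : 2 ≤ P.natDegree) :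
    ∃ μ : MeasureTheory.ProbabilityMeasure RiemannSphere,
      -- `μ` is a solution of `P^* μ / d = μ` without mass on the exceptional set,
      (((P.natDegree : ℝ≥0∞)⁻¹ • PolyDyn.pullback P (μ : Measure RiemannSphere) = μ ∧
          (μ : Measure RiemannSphere) (PolyDyn.exceptionalSet P) = 0) ∧
        -- and the only one;
        ∀ μ' : MeasureTheory.ProbabilityMeasure RiemannSphere,
          (P.natDegree : ℝ≥0∞)⁻¹ • PolyDyn.pullback P (μ' : Measure RiemannSphere) = μ' →
          (μ' : Measure RiemannSphere) (PolyDyn.exceptionalSet P) = 0 → μ' = μ) ∧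
      -- `(P^n)^* ν / d^n → μ` weakly for every `ν` without mass on the exceptional set;
      (∀ ν : MeasureTheory.ProbabilityMeasure RiemannSphere,
        (ν : Measure RiemannSphere) (PolyDyn.exceptionalSet P) = 0 →
        Tendsto (fun n : ℕ => PolyDyn.normalizedPullback P (by omega) n ν) atTop (𝓝 μ)) ∧
      -- `(P^n)^* δ_x / d^n → μ` weakly if and only if `x` is not exceptional.
      (∀ x : RiemannSphere,
        Tendsto (fun n : ℕ => PolyDyn.normalizedPullback P (by omega) n
          ⟨Measure.dirac x, Measure.dirac.isProbabilityMeasure⟩) atTop (𝓝 μ) ↔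
          x ∉ PolyDyn.exceptionalSet P) := by
  have hP0 : 0 < P.natDegree := by omega
  obtain ⟨y, hy⟩ := PolyDyn.exists_coe_notMem_exceptionalSet hP
  obtain ⟨μ, hμ⟩ := PolyDyn.exists_forall_tendsto_normalizedPullback_dirac hP hP0 hy
  have hμE := PolyDyn.measure_exceptionalSet_eq_zero hP hP0 hy (hμ _ hy)
  have hlim := PolyDyn.tendsto_normalizedPullback hP0 hμ
  refine ⟨μ, ⟨⟨?_, hμE⟩, fun μ' hμ' hμ'E => ?_⟩, hlim, fun x => ⟨fun hx hxE => ?_, hμ x⟩⟩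
  · rw [← PolyDyn.normalizedPullback_one hP0,
      PolyDyn.normalizedPullback_one_eq_of_tendsto hP hP0 (hμ _ hy)]
  · have hinv : PolyDyn.normalizedPullback P hP0 1 μ' = μ' :=
      Subtype.ext ((PolyDyn.normalizedPullback_one hP0 μ').trans hμ')
    refine tendsto_nhds_unique (ProbabilityMeasure.tendsto_iff_forall_lintegral_tendsto.2
      fun φ => ?_) (hlim μ' hμ'E)
    simp only [PolyDyn.normalizedPullback_eq_of_one_eq hP0 hinv _
      (PolyDyn.measurable_coe_comp φ.continuous)]
    exact tendsto_const_nhds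
  -- For exceptional `x` all iterated preimages stay in `E`. Convergence to `μ` would leave no mass
  -- on the open complement of `E`, while `μ(E) = 0`, contradicting total mass one.
  · obtain ⟨hfin, -, hpre⟩ := (PolyDyn.isGreatest_exceptionalSet hP).1
    have hcompl := PolyDyn.measure_eq_zero_of_tendsto hP0 hfin.isClosed.isOpen_compl
      (fun w hw hw' => hw (hpre ▸ hw')) (Set.notMem_compl_iff.2 hxE) hx
    have := measure_univ_le_add_compl (μ := (μ : Measure RiemannSphere))
      (PolyDyn.exceptionalSet P)
    rw [hμE, hcompl, measure_univ, add_zero] at this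
    exact one_ne_zero (le_zero_iff.1 this)
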